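/- Let $X$ be a random variable with values in $\{0,1,2,\ldots\}$ and mean $\mu$, whose probability generating function $X(z)=\sum_{k\ge0}P(X=k)z^k$ has radius of convergence $r>1$ (possibly $r=\infty$), and suppose that $|X(z)|<X(r_1)$ whenever $0<r_1<r$, $|z|=r_1$ and $z\ne r_1$. Fix $0<\gamma_{\min}\le\gamma_{\max}<\infty$. Then there are constants $C$ and $s_0$, depending only on the law of $X$, $\gamma_{\min}$ and $\gamma_{\max}$, such that the following holds for all integers $s\ge s_0$, all integers $n\ge 0$ and all $\gamma\in[\gamma_{\min},\gamma_{\max}]$ with $$\frac{n\mu}{s}=1-\frac{\gamma}{\sqrt s}.$$ Put $A(z)=X(z)^n$ and, for real $x$, $g(x)=-\ln x+\frac ns\ln X(x)$. Among the zeros of $z^s-A(z)$ in the annulus $1<|z|<r$ there is exactly one of minimum modulus, $Z_0$, and it is positive real; there is exactly one point $z_{sp}\in(1,Z_0)$ with $g'(z_{sp})=0$; and, with $B=\exp(s\,g(z_{sp}))$ and $\eta=g''(z_{sp})$, one has $0<B<1$ and $\eta>0$. Moreover, for every $\varepsilon>0$ with $1+\varepsilon<Z_0$ and every $Z\in\mathbb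 C$ with $|Z|\ge Z_0$ and $\mathrm{Re}\,Z>z_{sp}$, the integral $$I(Z)=\frac1{2\pi i}\int_{|z|=1+\varepsilon}\frac{\ln\bigl(1-z^{-s}A(z)\bigr)}{Z-z}\,dz$$ (principal logarithm) satisfies $$|I(Z)-J(d)|\le C\,s^{-1/2},$$ where $$d=(Z-z_{sp})\sqrt{s\eta/2},\qquad J(d)=\frac1\pi\int_0^\infty\frac{d}{t^2+d^2}\,\ln\bigl(1-Be^{-t^2}\bigr)\,dt.$$ -/

import Mathlib

open scoped ENNReal

noncomputable section

namespace ManySources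

/-- The probability generating function `X(z) = ∑ P(X = k) z^k` of a law `p` on `ℕ`. -/
def pgf (p : PMF ℕ) (z : ℂ) : ℂ := ∑' k : ℕ, ((p k).toReal : ℂ) * z ^ k

/-- The same power series at a real argument, as a real number. -/
def pgfReal (p : PMF ℕ) (x : ℝ) : ℝ := ∑' k : ℕ, (p k).toReal * x ^ k

/-- The radius of convergence `r ∈ [1, ∞]` of the probability generating function. -/
def pgfRadius (p : PMF ℕ) : ℝ≥0∞ :=
  (FormalMultilinearSeries.ofScalars ℂ (fun k : ℕ => ((p k).toReal : ℂ))).radius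

/-- The mean `μ = E X = X'(1)`. -/
def mean (p : PMF ℕ) : ℝ := ∑' k : ℕ, (k : ℝ) * (p k).toReal

/-- `A(z) = X(z)^n`, the probability generating function of the demand per period, which is a sum
of `n` independent copies of `X`. -/
def demandPgf (p : PMF ℕ) (n : ℕ) (z : ℂ) : ℂ := pgf p z ^ n

/-- The standing assumptions on `X`: the radius of convergence `r` exceeds `1`, and on each circle
`|z| = r₁` with `0 < r₁ < r` one has `|X(z)| < X(r₁)` except at `z = r₁`. -/
structure IsAdmissible (p : PMF ℕ) : Prop where
  one_lt_radius : 1 < pgfRadius p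
  norm_pgf_lt : ∀ r₁ : ℝ, 0 < r₁ → ENNReal.ofReal r₁ < pgfRadius p →
    ∀ z : ℂ, ‖z‖ = r₁ → z ≠ (r₁ : ℂ) → ‖pgf p z‖ < pgfReal p r₁

/-- `z` is a zero of `z^s - A(z)` in the annulus `1 < |z| < r`. -/
def IsOuterZero (p : PMF ℕ) (n s : ℕ) (z : ℂ) : Prop :=
  1 < ‖z‖ ∧ ENNReal.ofReal ‖z‖ < pgfRadius p ∧ z ^ s - demandPgf p n z = 0

/-- `Z₀` is the zero of `z^s - A(z)` in `1 < |z| < r` of minimum modulus: it is positive real, and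
every other zero in this annulus has strictly larger modulus. -/
def IsDominantZero (p : PMF ℕ) (n s : ℕ) (Z₀ : ℝ) : Prop :=
  0 < Z₀ ∧ IsOuterZero p n s (Z₀ : ℂ) ∧
    ∀ w : ℂ, IsOuterZero p n s w → w ≠ (Z₀ : ℂ) → Z₀ < ‖w‖

/-- `g(x) = - ln x + (n / s) ln X(x)` for real `x`. -/
def g (p : PMF ℕ) (n s : ℕ) (x : ℝ) : ℝ :=
  -Real.log x + (n : ℝ) / (s : ℝ) * Real.log (pgfReal p x)

/-- `z_sp` is the saddle point: the unique point of `(1, Z₀)` at which `g' = 0`. -/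
def IsSaddlePoint (p : PMF ℕ) (n s : ℕ) (Z₀ zsp : ℝ) : Prop :=
  (1 < zsp ∧ zsp < Z₀ ∧ HasDerivAt (g p n s) 0 zsp) ∧
    ∀ x : ℝ, 1 < x → x < Z₀ → HasDerivAt (g p n s) 0 x → x = zsp

/-- `B = exp (s g(z_sp))`. -/
def saddleB (p : PMF ℕ) (n s : ℕ) (zsp : ℝ) : ℝ := Real.exp ((s : ℝ) * g p n s zsp)

/-- `η = g''(z_sp)`. -/
def saddleEta (p : PMF ℕ) (n s : ℕ) (zsp : ℝ) : ℝ := deriv (deriv (g p n s)) zsp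

/-- The contour integral
`I(Z) = (2πi)⁻¹ ∫_{|z| = 1 + ε} ln (1 - z^{-s} A(z)) / (Z - z) dz`, with the principal logarithm. -/
def contourI (p : PMF ℕ) (n s : ℕ) (ε : ℝ) (Z : ℂ) : ℂ :=
  (2 * (Real.pi : ℂ) * Complex.I)⁻¹ *
    ∮ z in C(0, 1 + ε), Complex.log (1 - demandPgf p n z / z ^ s) / (Z - z)

/-- `J(d) = π⁻¹ ∫_0^∞ d / (t² + d²) ln (1 - B e^{-t²}) dt`, for complex `d`. -/
def J (B : ℝ) (d : ℂ) : ℂ :=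
  (Real.pi : ℂ)⁻¹ * ∫ t in Set.Ioi (0 : ℝ),
    d / ((t : ℂ) ^ 2 + d ^ 2) * ((Real.log (1 - B * Real.exp (-t ^ 2)) : ℝ) : ℂ)

end ManySources

end

noncomputable section

namespace ManySources

open Complex Set Filter Topology MeasureTheory

/-! In the variable `u = ln x`, with `λ = n/s` and `K(u) = ln X(e^u)`, the function `g` becomes
`G(u) = -u + λ K(u)`. Here `G(0) = 0`, `G'(0) = λμ - 1 = -γ/√s`, and `G''` lies between two positive
constants near `0`. Comparison with parabolas puts the critical point `w₀ = ln z_sp` and the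
positive zero `u₀ = ln Z₀` at distance of order `1/√s` from `0`, and shows that `s G(w₀)` is at most
a fixed negative number, so `B` stays away from `1` (`exists_critical_zero`). For `0 < u < u₀` one
has `|z^{-s}A(z)| ≤ e^{sG(u)} < 1` on `|z| = e^u`, so the contour may be moved freely there.

`Z` may have real part arbitrarily close to `z_sp`, so the line defining `J` may pass close to the
pole at `d`. Both integrals are therefore taken to the left of the saddle: the contour to the circle
of radius `e^{w₀/2}` (`contourI_eq_integral`), and `J` to the corresponding vertical line
(`J_eq_integral_scaled`). Writing `z = z_sp e^v` with `v = -w₀/2 + iθ`, both kernels are then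
`O(√s)` uniformly in `Z`, and the logarithm's argument still has modulus at most some `q < 1`.

The arguments of the logarithms are `exp(n K(w₀+v) - s(w₀+v))` and `B exp(κ²v²)`, with `κ² = s λ
K''(w₀)/2`. The linear term of the exponent vanishes at the saddle, so the exponents differ by
`O(s|v|³)`; the kernels differ by `O(|v|√s + |v|²s)`. With `|v|` of order `1/√s` the integrands
differ by `O(1)`, and the Gaussian decay of `X` in the angle (`IsAdmissible.exists_norm_pgf_le_exp`)
confines them to an interval of length of order `1/√s`. This gives `O(s^{-1/2})`. -/

/-! ### The generating function as a power series. -/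

theorem summable_toReal_mul_pow (p : PMF ℕ) {R : ℝ} (h0 : 0 ≤ R)
    (hR : ENNReal.ofReal R < pgfRadius p) : Summable fun k : ℕ => (p k).toReal * R ^ k := by
  have h : ((R.toNNReal : NNReal) : ℝ≥0∞) < pgfRadius p := hR
  have := FormalMultilinearSeries.summable_norm_mul_pow _ h
  simpa [FormalMultilinearSeries.ofScalars_norm, Real.coe_toNNReal R h0] using this

theorem ofReal_lt_pgfRadius_of_le {p : PMF ℕ} {x R : ℝ} (hx : x ≤ R)
    (hR : ENNReal.ofReal R < pgfRadius p) : ENNReal.ofReal x < pgfRadius p :=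
  (ENNReal.ofReal_le_ofReal hx).trans_lt hR

theorem pgf_ofReal (p : PMF ℕ) (x : ℝ) : pgf p (x : ℂ) = (pgfReal p x : ℂ) := by
  simp [pgf, pgfReal, Complex.ofReal_tsum]

theorem norm_pgf_term (p : PMF ℕ) (k : ℕ) (z : ℂ) :
    ‖((p k).toReal : ℂ) * z ^ k‖ = (p k).toReal * ‖z‖ ^ k := by
  rw [norm_mul, norm_pow, Complex.norm_real, Real.norm_of_nonneg ENNReal.toReal_nonneg]

theorem summable_norm_pgf_term (p : PMF ℕ) {z : ℂ} (hz : ENNReal.ofReal ‖z‖ < pgfRadius p) :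
    Summable fun k : ℕ => ‖((p k).toReal : ℂ) * z ^ k‖ := by
  simpa only [norm_pgf_term] using summable_toReal_mul_pow p (norm_nonneg z) hz

theorem norm_pgf_le (p : PMF ℕ) {z : ℂ} (hz : ENNReal.ofReal ‖z‖ < pgfRadius p) :
    ‖pgf p z‖ ≤ pgfReal p ‖z‖ := by
  refine (norm_tsum_le_tsum_norm (summable_norm_pgf_term p hz)).trans_eq ?_
  simp only [norm_pgf_term, pgfReal]

theorem pgf_term_bound (p : PMF ℕ) {R : ℝ} (i : ℕ) (w : ℂ) (hw : w ∈ Metric.ball (0 : ℂ) R) :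
    ‖((p i).toReal : ℂ) * w ^ i‖ ≤ (p i).toReal * R ^ i := by
  rw [norm_pgf_term]
  gcongr
  exact (mem_ball_zero_iff.1 hw).le

theorem differentiableOn_pgf (p : PMF ℕ) {R : ℝ} (h0 : 0 ≤ R)
    (hR : ENNReal.ofReal R < pgfRadius p) : DifferentiableOn ℂ (pgf p) (Metric.ball 0 R) :=
  Complex.differentiableOn_tsum_of_summable_norm (summable_toReal_mul_pow p h0 hR)
    (fun i => by fun_prop) Metric.isOpen_ball (fun i w hw => pgf_term_bound p i w hw)

theorem exists_gt_ofReal_lt_pgfRadius {p : PMF ℕ} {x : ℝ} (h : ENNReal.ofReal x < pgfRadius p) :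
    ∃ R, x < R ∧ 0 < R ∧ ENNReal.ofReal R < pgfRadius p := by
  obtain ⟨y, hy1, hy2⟩ := exists_between h
  have hyt : y ≠ ∞ := hy2.ne_top
  have hy0 : 0 < y.toReal := ENNReal.toReal_pos (ne_bot_of_gt hy1) hyt
  refine ⟨y.toReal, ?_, hy0, ?_⟩
  · rwa [← ENNReal.ofReal_toReal hyt, ENNReal.ofReal_lt_ofReal_iff hy0] at hy1
  · rwa [ENNReal.ofReal_toReal hyt]

theorem differentiableAt_pgf (p : PMF ℕ) {z : ℂ} (hz : ENNReal.ofReal ‖z‖ < pgfRadius p) :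
    DifferentiableAt ℂ (pgf p) z := by
  obtain ⟨R, h1, h2, h3⟩ := exists_gt_ofReal_lt_pgfRadius hz
  exact (differentiableOn_pgf p h2.le h3).differentiableAt
    (Metric.isOpen_ball.mem_nhds (mem_ball_zero_iff.2 h1))

theorem deriv_pgf_one (p : PMF ℕ) (h : 1 < pgfRadius p) : deriv (pgf p) 1 = (mean p : ℂ) := by
  obtain ⟨R, h1, h2, h3⟩ := exists_gt_ofReal_lt_pgfRadius (p := p) (x := 1) (by simpa using h)
  have := Complex.hasSum_deriv_of_summable_norm (z := 1) (summable_toReal_mul_pow p h2.le h3)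
    (F := fun k w => ((p k).toReal : ℂ) * w ^ k) (U := Metric.ball 0 R)
    (fun i => by fun_prop) Metric.isOpen_ball (fun i w hw => pgf_term_bound p i w hw) (by simpa)
  have h4 := this.tsum_eq
  change _ = deriv (pgf p) 1 at h4
  rw [← h4, mean, Complex.ofReal_tsum]
  congr 1
  ext k
  simp [mul_comm]

theorem pgfReal_one (p : PMF ℕ) : pgfReal p 1 = 1 := by
  simp only [pgfReal, one_pow, mul_one]
  rw [← ENNReal.tsum_toReal_eq (fun k => p.apply_ne_top k), p.tsum_coe, ENNReal.toReal_one]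

theorem pgfReal_pos (p : PMF ℕ) {x : ℝ} (h0 : 0 < x) (hx : ENNReal.ofReal x < pgfRadius p) :
    0 < pgfReal p x := by
  obtain ⟨k, hk⟩ := p.support_nonempty
  have hk' : 0 < (p k).toReal := ENNReal.toReal_pos ((p.mem_support_iff k).1 hk) (p.apply_ne_top k)
  refine (summable_toReal_mul_pow p h0.le hx).tsum_pos (fun i => by positivity) k (by positivity)

theorem pgfReal_mono (p : PMF ℕ) {x y : ℝ} (h0 : 0 ≤ x) (hxy : x ≤ y)
    (hy : ENNReal.ofReal y < pgfRadius p) : pgfReal p x ≤ pgfReal p y := by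
  refine Summable.tsum_le_tsum (fun i => ?_)
    (summable_toReal_mul_pow p h0 (ofReal_lt_pgfRadius_of_le hxy hy))
    (summable_toReal_mul_pow p (h0.trans hxy) hy)
  gcongr

/-! ### Gaussian decay of the generating function in the angle. -/

/-- An admissible law charges two different points. -/
theorem IsAdmissible.exists_lt_pos {p : PMF ℕ} (hp : IsAdmissible p) :
    ∃ j k : ℕ, j < k ∧ 0 < (p j).toReal ∧ 0 < (p k).toReal := by
  by_contra! hcon
  obtain ⟨j, hj⟩ := p.support_nonempty
  have hj' : 0 < (p j).toReal := ENNReal.toReal_pos ((p.mem_support_iff j).1 hj) (p.apply_ne_top j)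
  have hz : ∀ k, k ≠ j → (p k).toReal = 0 := by
    intro k hk
    rcases lt_or_gt_of_ne hk with h | h
    · by_contra hne
      have := hcon k j h (lt_of_le_of_ne ENNReal.toReal_nonneg (Ne.symm hne))
      linarith
    · exact le_antisymm (hcon j k h hj') ENNReal.toReal_nonneg
  have h1 : pgfReal p 1 = (p j).toReal := by
    simp only [pgfReal]
    rw [tsum_eq_single j (fun k hk => by simp [hz k hk])]
    simp
  have h2 : pgf p (-1) = (p j).toReal * (-1) ^ j := by
    simp only [pgf]
    rw [tsum_eq_single j (fun k hk => by simp [hz k hk])]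
  -- For a point mass `|X|` is constant on the unit circle, which contradicts strictness at `-1`.
  have h3 := hp.norm_pgf_lt 1 one_pos (by simpa using hp.one_lt_radius) (-1) (by simp)
    (by norm_num [Complex.ext_iff])
  rw [h2, h1] at h3
  simp at h3

/-- The squared modulus is `(a+b)² - 2ab(1 - cos φ)`, which is the square of the right side minus a
square. -/
theorem norm_add_mul_exp_le {a b φ : ℝ} (ha : 0 < a) (hb : 0 < b) :
    ‖(a : ℂ) + b * exp (φ * I)‖ ≤ a + b - a * b / (a + b) * (1 - Real.cos φ) := by
  have hab : 0 < a + b := by positivity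
  have hc := Real.neg_one_le_cos φ
  have hc' := Real.cos_le_one φ
  have hle : a * b / (a + b) * (1 - Real.cos φ) ≤ a + b := by
    rw [div_mul_eq_mul_div, div_le_iff₀ hab]
    nlinarith [mul_pos ha hb, sq_nonneg (a - b)]
  refine le_of_sq_le_sq ?_ (by linarith)
  have e1 : ‖(a : ℂ) + b * exp (φ * I)‖ ^ 2 = (a + b) ^ 2 - 2 * (a * b) * (1 - Real.cos φ) := by
    rw [Complex.sq_norm, Complex.normSq_apply, Complex.exp_mul_I, ← Complex.ofReal_cos,
      ← Complex.ofReal_sin]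
    simp only [add_re, mul_re, ofReal_re, ofReal_im, add_im, mul_im, I_re, I_im]
    linear_combination b ^ 2 * Real.sin_sq_add_cos_sq φ
  have e2 : (a + b) * (a * b / (a + b)) = a * b := by field_simp
  rw [e1]
  nlinarith [sq_nonneg (a * b / (a + b) * (1 - Real.cos φ))]

/-- Only the terms `j` and `k` are allowed to interfere; the others are bounded by the triangle
inequality. Since `ρ ≥ 1` and `ab/(a+b)` increases in both variables, the loss does not depend on
`ρ`. -/
theorem norm_pgf_le_sub {p : PMF ℕ} {j k : ℕ} (hjk : j < k) (hj : 0 < (p j).toReal)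
    (hk : 0 < (p k).toReal) {ρ : ℝ} (hρ : 1 ≤ ρ) (hr : ENNReal.ofReal ρ < pgfRadius p) (θ : ℝ) :
    ‖pgf p (ρ * exp (θ * I))‖ ≤ pgfReal p ρ -
      (p j).toReal * (p k).toReal / ((p j).toReal + (p k).toReal) *
        (1 - Real.cos (((k - j : ℕ) : ℝ) * θ)) := by
  have hρ0 : 0 < ρ := by linarith
  set z : ℂ := ρ * exp (θ * I) with hz
  have hzn : ‖z‖ = ρ := by
    rw [hz, norm_mul, Complex.norm_exp_ofReal_mul_I, Complex.norm_real, Real.norm_of_nonneg hρ0.le,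
      mul_one]
  have hs : Summable fun i : ℕ => ‖((p i).toReal : ℂ) * z ^ i‖ :=
    summable_norm_pgf_term p (by rwa [hzn])
  have hs' : Summable fun i : ℕ => (p i).toReal * ρ ^ i := summable_toReal_mul_pow p hρ0.le hr
  have hp1 : pgf p z = _ := (hs.of_norm.sum_add_tsum_compl (s := {j, k})).symm
  have hp2 : pgfReal p ρ = _ := (hs'.sum_add_tsum_compl (s := {j, k})).symm
  rw [Finset.sum_pair hjk.ne] at hp1 hp2
  have hrest : ‖∑' x : ↑((({j, k} : Finset ℕ) : Set ℕ)ᶜ), ((p x).toReal : ℂ) * z ^ (x : ℕ)‖ ≤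
      ∑' x : ↑((({j, k} : Finset ℕ) : Set ℕ)ᶜ), (p x).toReal * ρ ^ (x : ℕ) := by
    refine (norm_tsum_le_tsum_norm (hs.subtype _)).trans_eq ?_
    simp only [norm_pgf_term, hzn]
  set a : ℝ := (p j).toReal * ρ ^ j with ha
  set b : ℝ := (p k).toReal * ρ ^ k with hb
  have ha1 : (p j).toReal ≤ a := le_mul_of_one_le_right hj.le (one_le_pow₀ hρ)
  have hb1 : (p k).toReal ≤ b := le_mul_of_one_le_right hk.le (one_le_pow₀ hρ)
  have ha0 : 0 < a := hj.trans_le ha1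
  have hb0 : 0 < b := hk.trans_le hb1
  have hpair : ‖((p j).toReal : ℂ) * z ^ j + ((p k).toReal : ℂ) * z ^ k‖ ≤
      a + b - a * b / (a + b) * (1 - Real.cos (((k - j : ℕ) : ℝ) * θ)) := by
    have : ((p j).toReal : ℂ) * z ^ j + ((p k).toReal : ℂ) * z ^ k =
        exp (((j * θ : ℝ) : ℂ) * I) * (a + b * exp (((((k - j : ℕ) : ℝ) * θ : ℝ) : ℂ) * I)) := by
      rw [mul_add, mul_left_comm, ← Complex.exp_add, ← add_mul, ← Complex.ofReal_add]
      have : (j : ℝ) * θ + ((k - j : ℕ) : ℝ) * θ = k * θ := by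
        rw [Nat.cast_sub hjk.le]; ring
      rw [this, hz, mul_pow, mul_pow, ← Complex.exp_nat_mul, ← Complex.exp_nat_mul, ha, hb]
      push_cast
      ring_nf
    rw [this, norm_mul, Complex.norm_exp_ofReal_mul_I, one_mul]
    exact norm_add_mul_exp_le ha0 hb0
  have hfrac : (p j).toReal * (p k).toReal / ((p j).toReal + (p k).toReal) ≤ a * b / (a + b) := by
    rw [div_le_div_iff₀ (by positivity) (by positivity)]
    have h1 : (p j).toReal * (p k).toReal * a ≤ a * b * (p j).toReal := by
      nlinarith [mul_le_mul_of_nonneg_left hb1 (mul_pos hj ha0).le]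
    have h2 : (p j).toReal * (p k).toReal * b ≤ a * b * (p k).toReal := by
      nlinarith [mul_le_mul_of_nonneg_left ha1 (mul_pos hk hb0).le]
    linarith
  have hcos : 0 ≤ 1 - Real.cos (((k - j : ℕ) : ℝ) * θ) := by linarith [Real.cos_le_one (((k - j : ℕ) : ℝ) * θ)]
  have h5 := mul_le_mul_of_nonneg_right hfrac hcos
  rw [hp1, hp2]
  refine (norm_add_le _ _).trans ((add_le_add hpair hrest).trans ?_)
  linarith

/-- Gaussian decay in the angle of an admissible generating function, uniformly over the circles
of radius in `[1, R]`. -/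
theorem IsAdmissible.exists_norm_pgf_le_exp {p : PMF ℕ} (hp : IsAdmissible p) {R : ℝ} (hR1 : 1 ≤ R)
    (hR : ENNReal.ofReal R < pgfRadius p) :
    ∃ c > 0, ∀ ρ θ : ℝ, 1 ≤ ρ → ρ ≤ R → |θ| ≤ Real.pi →
      ‖pgf p (ρ * exp (θ * I))‖ ≤ pgfReal p ρ * Real.exp (-c * θ ^ 2) := by
  obtain ⟨j, k, hjk, hj, hk⟩ := hp.exists_lt_pos
  set m : ℕ := k - j with hm
  have hm1 : (1 : ℝ) ≤ m := by exact_mod_cast (by omega : 1 ≤ k - j)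
  set h : ℝ := (p j).toReal * (p k).toReal / ((p j).toReal + (p k).toReal) with hh
  have hh0 : 0 < h := by positivity
  have hXR : 0 < pgfReal p R := pgfReal_pos p (by linarith) hR
  have hπ := Real.pi_pos
  -- The factor `2/π²` comes from `cos x ≤ 1 - 2x²/π²` on `[-π, π]`; dividing by `X(R)` turns the
  -- subtracted loss into a factor `1 - c₁θ² ≤ exp(-c₁θ²)`.
  set c₁ : ℝ := h * (2 / Real.pi ^ 2) / pgfReal p R with hc₁
  have hc₁0 : 0 < c₁ := by positivity
  have small : ∀ ρ θ : ℝ, 1 ≤ ρ → ρ ≤ R → |θ| ≤ Real.pi / m →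
      ‖pgf p (ρ * exp (θ * I))‖ ≤ pgfReal p ρ * Real.exp (-c₁ * θ ^ 2) := by
    intro ρ θ h1 h2 hθ
    have hr := ofReal_lt_pgfRadius_of_le h2 hR
    have hX0 : 0 < pgfReal p ρ := pgfReal_pos p (by linarith) hr
    have hXle : pgfReal p ρ ≤ pgfReal p R := pgfReal_mono p (by linarith) h2 hR
    have hcos : Real.cos ((m : ℝ) * θ) ≤ 1 - 2 / Real.pi ^ 2 * ((m : ℝ) * θ) ^ 2 := by
      apply Real.cos_le_one_sub_mul_cos_sq
      rw [abs_mul, abs_of_pos (by linarith : (0 : ℝ) < m)]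
      rwa [le_div_iff₀ (by linarith), mul_comm] at hθ
    have hsq : θ ^ 2 ≤ ((m : ℝ) * θ) ^ 2 := by
      rw [mul_pow]
      exact le_mul_of_one_le_left (sq_nonneg _) (one_le_pow₀ hm1)
    have h3 : h * (2 / Real.pi ^ 2 * θ ^ 2) ≤ h * (1 - Real.cos ((m : ℝ) * θ)) := by
      apply mul_le_mul_of_nonneg_left _ hh0.le
      have : 2 / Real.pi ^ 2 * θ ^ 2 ≤ 2 / Real.pi ^ 2 * ((m : ℝ) * θ) ^ 2 := by gcongr
      linarith
    have h4 : pgfReal p ρ * (c₁ * θ ^ 2) ≤ h * (2 / Real.pi ^ 2 * θ ^ 2) := by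
      calc pgfReal p ρ * (c₁ * θ ^ 2) ≤ pgfReal p R * (c₁ * θ ^ 2) := by gcongr
        _ = _ := by rw [hc₁]; field_simp
    have h5 := norm_pgf_le_sub hjk hj hk h1 hr θ
    have h6 := Real.add_one_le_exp (-c₁ * θ ^ 2)
    have h7 := mul_le_mul_of_nonneg_left h6 hX0.le
    linarith
  -- Beyond `π/m` the two terms may be in phase again, so strictness and compactness replace the
  -- explicit bound.
  have large : ∃ q < 1, 0 < q ∧ ∀ ρ θ : ℝ, 1 ≤ ρ → ρ ≤ R → Real.pi / m ≤ |θ| → |θ| ≤ Real.pi →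
      ‖pgf p (ρ * exp (θ * I))‖ ≤ pgfReal p ρ * q := by
    set K : Set (ℝ × ℝ) := Icc 1 R ×ˢ (Icc (-Real.pi) (-(Real.pi / m)) ∪ Icc (Real.pi / m) Real.pi)
      with hK
    have hKc : IsCompact K := isCompact_Icc.prod (isCompact_Icc.union isCompact_Icc)
    have hmp : Real.pi / m ≤ Real.pi := div_le_self hπ.le hm1
    have hKn : K.Nonempty := ⟨(1, Real.pi), ⟨le_rfl, hR1⟩, Or.inr ⟨hmp, le_rfl⟩⟩
    have hnorm : ∀ ρ θ : ℝ, 1 ≤ ρ → ‖(ρ : ℂ) * exp (θ * I)‖ = ρ := by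
      intro ρ θ h1
      rw [norm_mul, Complex.norm_exp_ofReal_mul_I, Complex.norm_real,
        Real.norm_of_nonneg (by linarith), mul_one]
    have hcont : ContinuousOn (fun x : ℝ × ℝ => ‖pgf p (x.1 * exp (x.2 * I))‖ / ‖pgf p x.1‖) K := by
      intro x hx
      have hr := ofReal_lt_pgfRadius_of_le hx.1.2 hR
      have h1 : (1 : ℝ) ≤ x.1 := hx.1.1
      have c1 : ContinuousAt (pgf p) ((x.1 : ℂ) * exp (x.2 * I)) :=
        (differentiableAt_pgf p (by rwa [hnorm _ _ h1])).continuousAt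
      have c2 : ContinuousAt (pgf p) (x.1 : ℂ) :=
        (differentiableAt_pgf p (by rwa [Complex.norm_real, Real.norm_of_nonneg (by linarith)])).continuousAt
      have d1 : ContinuousAt (fun x : ℝ × ℝ => pgf p (x.1 * exp (x.2 * I))) x :=
        ContinuousAt.comp (f := fun x : ℝ × ℝ => (x.1 : ℂ) * exp (x.2 * I)) c1 (by fun_prop)
      have d2 : ContinuousAt (fun x : ℝ × ℝ => pgf p (x.1 : ℂ)) x :=
        ContinuousAt.comp (f := fun x : ℝ × ℝ => (x.1 : ℂ)) c2 (by fun_prop)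
      refine (d1.norm.div d2.norm ?_).continuousWithinAt
      rw [pgf_ofReal, Complex.norm_real]
      exact (norm_pos_iff.2 (pgfReal_pos p (by linarith) hr).ne').ne'
    obtain ⟨x₀, hx₀, hmax⟩ := hKc.exists_isMaxOn hKn hcont
    have hpt : ∀ x ∈ K, ‖pgf p (x.1 * exp (x.2 * I))‖ / ‖pgf p x.1‖ < 1 := by
      intro x hx
      have hr := ofReal_lt_pgfRadius_of_le hx.1.2 hR
      have h1 : (1 : ℝ) ≤ x.1 := hx.1.1
      have hpos := pgfReal_pos p (by linarith) hr
      rw [pgf_ofReal, Complex.norm_real, Real.norm_of_nonneg hpos.le, div_lt_one hpos]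
      refine hp.norm_pgf_lt x.1 (by linarith) hr _ (hnorm _ _ h1) ?_
      intro heq
      have hx1 : (x.1 : ℂ) ≠ 0 := by
        rw [Complex.ofReal_ne_zero]; linarith
      have he : exp (x.2 * I) = 1 := by
        apply mul_left_cancel₀ hx1
        rw [heq, mul_one]
      have hcos : Real.cos x.2 = 1 := by
        have := congrArg Complex.re he
        rwa [Complex.exp_ofReal_mul_I_re, Complex.one_re] at this
      have hpm : 0 < Real.pi / m := by positivity
      have hx2 : x.2 = 0 := by
        rcases hx.2 with h | h
        · exact (Real.cos_eq_one_iff_of_lt_of_lt (by linarith [h.1, h.2]) (by linarith [h.1, h.2])).1 hcos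
        · exact (Real.cos_eq_one_iff_of_lt_of_lt (by linarith [h.1, h.2]) (by linarith [h.1, h.2])).1 hcos
      rcases hx.2 with h | h
      · linarith [h.1, h.2]
      · linarith [h.1, h.2]
    -- The `1/2` keeps `q` positive, so that its logarithm can be used below.
    refine ⟨max (1 / 2) (‖pgf p (x₀.1 * exp (x₀.2 * I))‖ / ‖pgf p x₀.1‖),
      max_lt (by norm_num) (hpt x₀ hx₀), lt_max_of_lt_left (by norm_num), ?_⟩
    intro ρ θ h1 h2 h3 h4
    have hmem : (ρ, θ) ∈ K := by
      refine ⟨⟨h1, h2⟩, ?_⟩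
      rcases le_total 0 θ with h | h
      · rw [abs_of_nonneg h] at h3 h4
        exact Or.inr ⟨h3, h4⟩
      · rw [abs_of_nonpos h] at h3 h4
        exact Or.inl ⟨by simp only; linarith, by simp only; linarith⟩
    have h5 := (isMaxOn_iff.1 hmax _ hmem).trans (le_max_right (1 / 2) _)
    have hpos := pgfReal_pos p (by linarith) (ofReal_lt_pgfRadius_of_le h2 hR)
    simp only at h5
    rw [pgf_ofReal p ρ, Complex.norm_real, Real.norm_of_nonneg hpos.le, div_le_iff₀ hpos] at h5
    rw [mul_comm (pgfReal p ρ)]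
    exact h5
  obtain ⟨q, hq1, hq0, hq⟩ := large
  -- Chosen so that `exp(-c₂π²) = q`.
  set c₂ : ℝ := -Real.log q / Real.pi ^ 2 with hc₂
  have hc₂0 : 0 < c₂ := div_pos (neg_pos.2 (Real.log_neg hq0 hq1)) (by positivity)
  refine ⟨min c₁ c₂, lt_min hc₁0 hc₂0, ?_⟩
  intro ρ θ h1 h2 h3
  have hpos := pgfReal_pos p (by linarith) (ofReal_lt_pgfRadius_of_le h2 hR)
  rcases le_total |θ| (Real.pi / m) with h | h
  · refine (small ρ θ h1 h2 h).trans ?_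
    gcongr
    exact min_le_left _ _
  · refine (hq ρ θ h1 h2 h h3).trans ?_
    gcongr
    rw [← Real.log_le_iff_le_exp hq0]
    have hθ : θ ^ 2 ≤ Real.pi ^ 2 := by
      rw [← sq_abs θ]; gcongr
    have : min c₁ c₂ * θ ^ 2 ≤ c₂ * Real.pi ^ 2 := by
      gcongr
      exact min_le_right _ _
    rw [hc₂, div_mul_cancel₀ _ (by positivity)] at this
    linarith

/-! ### The cumulant generating function near the origin. -/

/-- Taylor's formula of order two with a cubic remainder, for a function analytic on a disc. -/
theorem norm_sub_taylor_two_le {f : ℂ → ℂ} {δ M : ℝ}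
    (hf : ∀ w ∈ Metric.ball (0 : ℂ) δ, AnalyticAt ℂ f w)
    (hM : ∀ w ∈ Metric.ball (0 : ℂ) δ, ‖deriv (deriv (deriv f)) w‖ ≤ M) {u v : ℂ}
    (huv : ‖u‖ + ‖v‖ < δ) :
    ‖f (u + v) - f u - deriv f u * v - deriv (deriv f) u * v ^ 2 / 2‖ ≤ M * ‖v‖ ^ 3 := by
  set S := Metric.closedBall u ‖v‖ with hS
  have hsub : ∀ w ∈ S, w ∈ Metric.ball (0 : ℂ) δ := by
    intro w hw
    rw [mem_ball_zero_iff]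
    rw [hS, mem_closedBall_iff_norm] at hw
    calc ‖w‖ = ‖u + (w - u)‖ := by congr 1; ring
      _ ≤ ‖u‖ + ‖w - u‖ := norm_add_le _ _
      _ < δ := by linarith
  have hconv : Convex ℝ S := convex_closedBall u ‖v‖
  have hu : u ∈ S := Metric.mem_closedBall_self (norm_nonneg v)
  have hM0 : 0 ≤ M := (norm_nonneg _).trans (hM u (hsub u hu))
  have d0 : ∀ w ∈ S, HasDerivAt f (deriv f w) w :=
    fun w hw => (hf w (hsub w hw)).differentiableAt.hasDerivAt
  have d1 : ∀ w ∈ S, HasDerivAt (deriv f) (deriv (deriv f) w) w :=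
    fun w hw => (hf w (hsub w hw)).deriv.differentiableAt.hasDerivAt
  have d2 : ∀ w ∈ S, HasDerivAt (deriv (deriv f)) (deriv (deriv (deriv f)) w) w :=
    fun w hw => (hf w (hsub w hw)).deriv.deriv.differentiableAt.hasDerivAt
  have hdist : ∀ w ∈ S, ‖w - u‖ ≤ ‖v‖ := fun w hw => by
    rwa [hS, mem_closedBall_iff_norm] at hw
  have b2 : ∀ w ∈ S, ‖deriv (deriv f) w - deriv (deriv f) u‖ ≤ M * ‖v‖ := by
    intro w hw
    refine (hconv.norm_image_sub_le_of_norm_hasDerivWithin_le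
      (fun x hx => (d2 x hx).hasDerivWithinAt) (fun x hx => hM x (hsub x hx)) hu hw).trans ?_
    gcongr
    exact hdist w hw
  have b1 : ∀ w ∈ S, ‖deriv f w - deriv f u - deriv (deriv f) u * (w - u)‖ ≤ M * ‖v‖ * ‖v‖ := by
    intro w hw
    have h1 : ∀ x ∈ S, HasDerivWithinAt
        (fun x => deriv f x - deriv f u - deriv (deriv f) u * (x - u))
        (deriv (deriv f) x - deriv (deriv f) u) S x := by
      intro x hx
      have := ((d1 x hx).sub_const (deriv f u)).sub
        (((hasDerivAt_id x).sub_const u).const_mul (deriv (deriv f) u))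
      exact (this.congr_deriv (by simp)).hasDerivWithinAt
    have := hconv.norm_image_sub_le_of_norm_hasDerivWithin_le h1 b2 hu hw
    simp only [sub_self, mul_zero, sub_zero] at this
    refine this.trans ?_
    gcongr
    exact hdist w hw
  have huv' : u + v ∈ S := by simp [hS]
  have h0 : ∀ x ∈ S, HasDerivWithinAt
      (fun x => f x - f u - deriv f u * (x - u) - deriv (deriv f) u * (x - u) ^ 2 / 2)
      (deriv f x - deriv f u - deriv (deriv f) u * (x - u)) S x := by
    intro x hx
    have e1 : HasDerivAt (fun x : ℂ => (x - u) ^ 2) (2 * (x - u)) x := by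
      exact (((hasDerivAt_id x).sub_const u).pow 2).congr_deriv (by simp)
    have e2 := (((d0 x hx).sub_const (f u)).sub
        (((hasDerivAt_id x).sub_const u).const_mul (deriv f u))).sub
        ((e1.const_mul (deriv (deriv f) u)).div_const 2)
    refine (e2.congr_deriv ?_).hasDerivWithinAt
    ring
  have := hconv.norm_image_sub_le_of_norm_hasDerivWithin_le h0 b1 hu huv'
  simp only [sub_self, mul_zero, sub_zero, add_sub_cancel_left, ne_eq, OfNat.ofNat_ne_zero,
    not_false_eq_true, zero_pow, zero_div] at this
  refine this.trans_eq (by ring)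

/-- The cumulant generating function `ln X(e^w)`. -/
def cgf (p : PMF ℕ) (w : ℂ) : ℂ := Complex.log (pgf p (exp w))

/-- The cumulant generating function at a real argument. -/
def cgfReal (p : PMF ℕ) (u : ℝ) : ℝ := Real.log (pgfReal p (Real.exp u))

theorem cgf_ofReal (p : PMF ℕ) {u : ℝ} (hu : ENNReal.ofReal (Real.exp u) < pgfRadius p) :
    cgf p u = (cgfReal p u : ℂ) := by
  rw [cgf, cgfReal, ← Complex.ofReal_exp, pgf_ofReal, Complex.ofReal_log]
  exact (pgfReal_pos p (Real.exp_pos u) hu).le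

/-- `ψ₁`, `ψ₂` are the first two derivatives on `(-δ, δ)` of the real cumulant generating
function, with `ψ₂` comparable to `m`, and `M` controls the cubic remainder on the disc. -/
structure CgfControl (p : PMF ℕ) (δ m M : ℝ) (ψ₁ ψ₂ : ℝ → ℝ) : Prop where
  radius_pos : 0 < δ
  radius_le : δ ≤ 1
  m_pos : 0 < m
  M_nonneg : 0 ≤ M
  lt_radius : ENNReal.ofReal (Real.exp δ) < pgfRadius p
  hasDerivAt : ∀ u : ℝ, |u| < δ → HasDerivAt (cgfReal p) (ψ₁ u) u
  hasDerivAt' : ∀ u : ℝ, |u| < δ → HasDerivAt ψ₁ (ψ₂ u) u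
  at_zero : ψ₁ 0 = mean p
  le_second : ∀ u : ℝ, |u| < δ → m ≤ ψ₂ u
  second_le : ∀ u : ℝ, |u| < δ → ψ₂ u ≤ 2 * m
  exp_cgf : ∀ w : ℂ, ‖w‖ < δ → exp (cgf p w) = pgf p (exp w)
  taylor : ∀ (u : ℝ) (v : ℂ), |u| + ‖v‖ < δ →
    ‖cgf p (u + v) - cgfReal p u - ψ₁ u * v - ψ₂ u * v ^ 2 / 2‖ ≤ M * ‖v‖ ^ 3

theorem IsAdmissible.exists_cgfControl {p : PMF ℕ} (hp : IsAdmissible p) :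
    ∃ (δ m M : ℝ) (ψ₁ ψ₂ : ℝ → ℝ), CgfControl p δ m M ψ₁ ψ₂ := by
  obtain ⟨R, hR1, hR0, hR⟩ := exists_gt_ofReal_lt_pgfRadius (p := p) (x := 1)
    (by simpa using hp.one_lt_radius)
  have hpgf1 : pgf p 1 = 1 := by
    have := pgf_ofReal p 1
    rwa [pgfReal_one, Complex.ofReal_one] at this
  have ha1 : AnalyticAt ℂ (pgf p) (exp 0) :=
    (differentiableOn_pgf p hR0.le hR).analyticAt
      (Metric.isOpen_ball.mem_nhds (by simpa using hR1))
  have ha : AnalyticAt ℂ (cgf p) 0 := by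
    refine AnalyticAt.clog (ha1.comp (f := exp) (by fun_prop)) ?_
    simp [hpgf1]
  have hexpc : Tendsto (fun w : ℂ => ‖exp w‖) (𝓝 0) (𝓝 1) := by
    have : ContinuousAt (fun w : ℂ => ‖exp w‖) 0 := by fun_prop
    simpa [ContinuousAt] using this
  have hne : ∀ᶠ w : ℂ in 𝓝 0, pgf p (exp w) ≠ 0 := by
    have : ContinuousAt (fun w : ℂ => pgf p (exp w)) 0 :=
      ContinuousAt.comp (f := exp) ha1.continuousAt (by fun_prop)
    exact this.eventually_ne (by simp [hpgf1])
  set M : ℝ := ‖deriv (deriv (deriv (cgf p))) 0‖ + 1 with hMdef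
  have hM0 : 0 ≤ M := by positivity
  have hM : ∀ᶠ w : ℂ in 𝓝 0, ‖deriv (deriv (deriv (cgf p))) w‖ < M :=
    ha.deriv.deriv.deriv.continuousAt.norm.eventually_lt_const (by rw [hMdef]; linarith)
  obtain ⟨δ₁, hδ₁, hall⟩ := Metric.eventually_nhds_iff_ball.1
    (ha.eventually_analyticAt.and (hne.and (hM.and (hexpc.eventually_lt_const hR1))))
  set ψ₁ : ℝ → ℝ := fun u => (deriv (cgf p) u).re with hψ₁
  set ψ₂ : ℝ → ℝ := fun u => (deriv (deriv (cgf p)) u).re with hψ₂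
  have hmem : ∀ u : ℝ, |u| < δ₁ → (u : ℂ) ∈ Metric.ball (0 : ℂ) δ₁ := by
    intro u hu
    rwa [mem_ball_zero_iff, Complex.norm_real, Real.norm_eq_abs]
  have hrad : ∀ u : ℝ, |u| < δ₁ → ENNReal.ofReal (Real.exp u) < pgfRadius p := by
    intro u hu
    have := (hall u (hmem u hu)).2.2.2
    rw [Complex.norm_exp, Complex.ofReal_re] at this
    exact ofReal_lt_pgfRadius_of_le this.le hR
  have hev : ∀ u : ℝ, |u| < δ₁ → ∀ᶠ x : ℝ in 𝓝 u, |x| < δ₁ := fun u hu =>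
    continuous_abs.continuousAt.eventually_lt_const hu
  have hd0 : ∀ u : ℝ, |u| < δ₁ → HasDerivAt (fun x : ℝ => ((cgfReal p x : ℝ) : ℂ)) (deriv (cgf p) u) u := by
    intro u hu
    refine ((hall u (hmem u hu)).1.differentiableAt.hasDerivAt.comp_ofReal).congr_of_eventuallyEq ?_
    filter_upwards [hev u hu] with x hx
    exact (cgf_ofReal p (hrad x hx)).symm
  have hd1 : ∀ u : ℝ, |u| < δ₁ → HasDerivAt (cgfReal p) (ψ₁ u) u := by
    intro u hu
    have := (Complex.reCLM.hasFDerivAt.comp_hasDerivAt u (hd0 u hu))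
    exact this
  -- A function that is real on the real axis has real derivatives there.
  have hre1 : ∀ u : ℝ, |u| < δ₁ → deriv (cgf p) u = (ψ₁ u : ℂ) := fun u hu =>
    (hd0 u hu).unique (hd1 u hu).ofReal_comp
  have hd0' : ∀ u : ℝ, |u| < δ₁ → HasDerivAt (fun x : ℝ => ((ψ₁ x : ℝ) : ℂ)) (deriv (deriv (cgf p)) u) u := by
    intro u hu
    refine ((hall u (hmem u hu)).1.deriv.differentiableAt.hasDerivAt.comp_ofReal).congr_of_eventuallyEq ?_
    filter_upwards [hev u hu] with x hx
    exact (hre1 x hx).symm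
  have hd2 : ∀ u : ℝ, |u| < δ₁ → HasDerivAt ψ₁ (ψ₂ u) u := by
    intro u hu
    have := (Complex.reCLM.hasFDerivAt.comp_hasDerivAt u (hd0' u hu))
    exact this
  have hre2 : ∀ u : ℝ, |u| < δ₁ → deriv (deriv (cgf p)) u = (ψ₂ u : ℂ) := fun u hu =>
    (hd0' u hu).unique (hd2 u hu).ofReal_comp
  have htaylor : ∀ (u : ℝ) (v : ℂ), |u| + ‖v‖ < δ₁ →
      ‖cgf p (u + v) - cgfReal p u - ψ₁ u * v - ψ₂ u * v ^ 2 / 2‖ ≤ M * ‖v‖ ^ 3 := by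
    intro u v huv
    have hu : |u| < δ₁ := by linarith [norm_nonneg v]
    have := norm_sub_taylor_two_le (u := (u : ℂ)) (v := v) (fun w hw => (hall w hw).1)
      (fun w hw => (hall w hw).2.2.1.le) (by rwa [Complex.norm_real, Real.norm_eq_abs])
    rwa [hre1 u hu, hre2 u hu, cgf_ofReal p (hrad u hu)] at this
  have hexpcgf : ∀ w : ℂ, ‖w‖ < δ₁ → exp (cgf p w) = pgf p (exp w) := fun w hw =>
    Complex.exp_log (hall w (mem_ball_zero_iff.2 hw)).2.1
  have h00 : cgfReal p 0 = 0 := by simp [cgfReal, pgfReal_one]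
  have hψ10 : ψ₁ 0 = mean p := by
    have h1 : HasDerivAt (fun w => pgf p (exp w)) (deriv (pgf p) (exp 0) * exp 0) 0 :=
      (ha1.differentiableAt.hasDerivAt).comp 0 (Complex.hasDerivAt_exp 0)
    have h2 := h1.clog (by simp [hpgf1])
    have h3 : deriv (cgf p) 0 = _ := h2.deriv
    have h4 := hre1 0 (by simpa using hδ₁)
    rw [Complex.ofReal_zero, h3, Complex.exp_zero, hpgf1, deriv_pgf_one p hp.one_lt_radius] at h4
    simp at h4
    exact_mod_cast h4.symm
  -- Positivity of the variance from the decay on the unit circle: `Re cgf(iθ)` is at most `-cθ²`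
  -- and at least `-ψ₂(0)θ²/2 - Mθ³`. With `Mθ ≤ c/2` this yields `ψ₂(0) ≥ c`.
  have hψ20 : 0 < ψ₂ 0 := by
    obtain ⟨c, hc, hdecay⟩ := hp.exists_norm_pgf_le_exp le_rfl
      (by simpa using hp.one_lt_radius : ENNReal.ofReal 1 < pgfRadius p)
    set θ : ℝ := min (min (δ₁ / 2) 1) (c / (2 * (M + 1))) with hθ
    have hθ0 : 0 < θ := by
      refine lt_min (lt_min (by linarith) one_pos) (by positivity)
    have hθ1 : θ < δ₁ := ((min_le_left _ _).trans (min_le_left _ _)).trans_lt (by linarith)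
    have hθ2 : θ ≤ 1 := (min_le_left _ _).trans (min_le_right _ _)
    have hθ3 : M * θ ≤ c / 2 := by
      calc M * θ ≤ (M + 1) * (c / (2 * (M + 1))) := by
            gcongr
            · linarith
            · exact min_le_right _ _
        _ = c / 2 := by field_simp
    have hn : ‖(θ : ℂ) * I‖ = θ := by
      rw [norm_mul, Complex.norm_I, mul_one, Complex.norm_real, Real.norm_of_nonneg hθ0.le]
    have h1 := htaylor 0 (θ * I) (by rw [hn]; simpa using hθ1)
    have h2 := (Complex.abs_re_le_norm _).trans h1
    have h3 := hexpcgf (θ * I) (by rwa [hn])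
    have h4 := hdecay 1 θ le_rfl le_rfl (by rw [abs_of_pos hθ0]; linarith [Real.pi_gt_three])
    rw [Complex.ofReal_one, one_mul, ← h3, Complex.norm_exp, pgfReal_one, one_mul,
      Real.exp_le_exp] at h4
    have h5 : (cgf p ((0 : ℝ) + θ * I) - cgfReal p 0 - ψ₁ 0 * (θ * I) -
        ψ₂ 0 * (θ * I) ^ 2 / 2).re = (cgf p (θ * I)).re + ψ₂ 0 * θ ^ 2 / 2 := by
      have : (ψ₂ 0 : ℂ) * (θ * I) ^ 2 / 2 = ((-(ψ₂ 0 * θ ^ 2 / 2) : ℝ) : ℂ) := by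
        rw [mul_pow, Complex.I_sq]; push_cast; ring
      rw [h00, this, Complex.sub_re, Complex.ofReal_re]
      simp
    rw [h5, hn] at h2
    have h6 := neg_le_of_abs_le h2
    have h7 : M * θ ^ 3 ≤ c / 2 * θ ^ 2 := by
      calc M * θ ^ 3 = M * θ * θ ^ 2 := by ring
        _ ≤ _ := by gcongr
    have h8 : c * θ ^ 2 ≤ ψ₂ 0 * θ ^ 2 := by nlinarith
    exact hc.trans_le (le_of_mul_le_mul_right h8 (by positivity))
  -- This places `ψ₂(0)` strictly between `m` and `2m`, so by continuity the bounds persist nearby.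
  set m : ℝ := 2 / 3 * ψ₂ 0 with hm
  have hm0 : 0 < m := by positivity
  have hcont2 : ContinuousAt ψ₂ 0 := by
    have h1 : ContinuousAt (deriv (deriv (cgf p))) ((0 : ℝ) : ℂ) := by
      simpa using ha.deriv.deriv.continuousAt
    exact Complex.continuous_re.continuousAt.comp (h1.comp (f := fun x : ℝ => (x : ℂ)) (by fun_prop))
  have hlow : ∀ᶠ u in 𝓝 0, m < ψ₂ u := hcont2.eventually_const_lt (by rw [hm]; linarith)
  have hupp : ∀ᶠ u in 𝓝 0, ψ₂ u < 2 * m := hcont2.eventually_lt_const (by rw [hm]; linarith)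
  obtain ⟨δ₂, hδ₂, hall₂⟩ := Metric.eventually_nhds_iff_ball.1 (hlow.and hupp)
  set δ : ℝ := min (min (δ₁ / 2) δ₂) 1 with hδ
  have hδ0 : 0 < δ := lt_min (lt_min (by linarith) hδ₂) one_pos
  have hδl : δ < δ₁ := ((min_le_left _ _).trans (min_le_left _ _)).trans_lt (by linarith)
  have hδl₂ : δ ≤ δ₂ := (min_le_left _ _).trans (min_le_right _ _)
  refine ⟨δ, m, M, ψ₁, ψ₂, hδ0, min_le_right _ _, hm0, hM0, ?_, ?_, ?_, hψ10, ?_, ?_, ?_, ?_⟩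
  · exact hrad δ (by rwa [abs_of_pos hδ0])
  · exact fun u hu => hd1 u (hu.trans hδl)
  · exact fun u hu => hd2 u (hu.trans hδl)
  · exact fun u hu => (hall₂ u (by
      rw [mem_ball_zero_iff, Real.norm_eq_abs]; exact hu.trans_le hδl₂)).1.le
  · exact fun u hu => (hall₂ u (by
      rw [mem_ball_zero_iff, Real.norm_eq_abs]; exact hu.trans_le hδl₂)).2.le
  · exact fun w hw => hexpcgf w (hw.trans hδl)
  · exact fun u v huv => htaylor u v (huv.trans hδl)

/-! ### Critical point and zero of a convex function of one variable. -/

theorem le_of_hasDerivAt_nonneg {f f' : ℝ → ℝ} {x y : ℝ} (hxy : x ≤ y)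
    (hd : ∀ u ∈ Icc x y, HasDerivAt f (f' u) u) (h0 : ∀ u ∈ Icc x y, 0 ≤ f' u) : f x ≤ f y := by
  refine monotoneOn_of_deriv_nonneg (convex_Icc x y)
    (fun u hu => (hd u hu).continuousAt.continuousWithinAt)
    (fun u hu => (hd u (interior_subset hu)).differentiableAt.differentiableWithinAt)
    (fun u hu => ?_) (left_mem_Icc.2 hxy) (right_mem_Icc.2 hxy) hxy
  rw [(hd u (interior_subset hu)).deriv]
  exact h0 u (interior_subset hu)

/-- A convex function with `G 0 = 0`, `G' 0 = -τ` and curvature between `a` and `2 a`: location of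
its critical point `w₀` and of its positive zero `u₀`. -/
theorem exists_critical_zero {G G₁ G₂ : ℝ → ℝ} {δ a τ : ℝ} (ha : 0 < a) (hτ : 0 < τ)
    (hδ : 3 * τ / a < δ) (hG : ∀ u, |u| < δ → HasDerivAt G (G₁ u) u)
    (hG₁ : ∀ u, |u| < δ → HasDerivAt G₁ (G₂ u) u) (hle : ∀ u, |u| < δ → a ≤ G₂ u)
    (hge : ∀ u, |u| < δ → G₂ u ≤ 2 * a) (h0 : G 0 = 0) (h1 : G₁ 0 = -τ) :
    ∃ w₀ u₀ : ℝ, 0 < w₀ ∧ w₀ < u₀ ∧ u₀ ≤ 3 * τ / a ∧ G₁ w₀ = 0 ∧ G u₀ = 0 ∧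
      (∀ u, 0 < u → u < u₀ → G u < 0) ∧ (∀ u, 0 < u → u < δ → G₁ u = 0 → u = w₀) ∧
      τ / (2 * a) ≤ w₀ ∧ w₀ ≤ τ / a ∧ G (w₀ / 2) ≤ -(3 / 8 * a * w₀ ^ 2) ∧
      G w₀ ≤ -(a * w₀ ^ 2 / 2) := by
  have habs : ∀ {x y u : ℝ}, 0 ≤ x → y < δ → u ∈ Icc x y → |u| < δ := by
    intro x y u hx hy hu
    rw [abs_of_nonneg (hx.trans hu.1)]
    exact hu.2.trans_lt hy
  have lower : ∀ {x y : ℝ}, 0 ≤ x → x ≤ y → y < δ → a * (y - x) ≤ G₁ y - G₁ x := by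
    intro x y hx hxy hy
    have := le_of_hasDerivAt_nonneg (f := fun u => G₁ u - a * u) (f' := fun u => G₂ u - a) hxy
      (fun u hu => ((hG₁ u (habs hx hy hu)).sub ((hasDerivAt_id u).const_mul a)).congr_deriv
        (by simp)) (fun u hu => sub_nonneg.2 (hle u (habs hx hy hu)))
    linarith
  have upper : ∀ {x y : ℝ}, 0 ≤ x → x ≤ y → y < δ → G₁ y - G₁ x ≤ 2 * a * (y - x) := by
    intro x y hx hxy hy
    have := le_of_hasDerivAt_nonneg (f := fun u => 2 * a * u - G₁ u)
      (f' := fun u => 2 * a - G₂ u) hxy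
      (fun u hu => (((hasDerivAt_id u).const_mul (2 * a)).sub (hG₁ u (habs hx hy hu))).congr_deriv
        (by simp)) (fun u hu => sub_nonneg.2 (hge u (habs hx hy hu)))
    linarith
  have hτa : 0 < τ / a := by positivity
  have h3 : 3 * τ / a = 3 * (τ / a) := by ring
  have hτδ : τ / a < δ := by linarith
  have haτ : a * (τ / a) = τ := by field_simp
  -- the critical point
  obtain ⟨w₀, hw₀, hw₀z⟩ : ∃ w₀ ∈ Icc 0 (τ / a), G₁ w₀ = 0 := by
    have hc : ContinuousOn G₁ (Icc 0 (τ / a)) := fun u hu =>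
      (hG₁ u (habs le_rfl hτδ hu)).continuousAt.continuousWithinAt
    refine intermediate_value_Icc hτa.le hc ⟨by linarith, ?_⟩
    have := lower le_rfl hτa.le hτδ
    rw [sub_zero, haτ, h1] at this
    linarith
  have hw₀δ : w₀ < δ := hw₀.2.trans_lt hτδ
  have hlow : τ / (2 * a) ≤ w₀ := by
    have := upper le_rfl hw₀.1 hw₀δ
    rw [hw₀z, h1] at this
    rw [div_le_iff₀ (by positivity)]
    linarith
  have hw₀0 : 0 < w₀ := lt_of_lt_of_le (by positivity) hlow
  have huniq : ∀ u, 0 < u → u < δ → G₁ u = 0 → u = w₀ := by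
    intro u hu hud hz
    rcases le_total u w₀ with h | h
    · have := lower hu.le h hw₀δ
      rw [hz, hw₀z] at this
      nlinarith
    · have := lower hw₀0.le h hud
      rw [hz, hw₀z] at this
      nlinarith
  -- Integrate `G₁(x) ≤ -a(w₀ - x)` from `0`; the values at `w₀/2` and `w₀` give the last two
  -- bounds.
  have hleft : ∀ u, 0 ≤ u → u ≤ w₀ → G u ≤ -(a / 2 * (w₀ ^ 2 - (w₀ - u) ^ 2)) := by
    intro u hu huw
    have := le_of_hasDerivAt_nonneg (f := fun u => -(G u) - a * w₀ * u + a / 2 * u ^ 2)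
      (f' := fun u => -(G₁ u) - a * (w₀ - u)) hu
      (fun x hx => by
        have e := (((hG x (habs le_rfl (huw.trans_lt hw₀δ) hx)).neg.sub
          ((hasDerivAt_id x).const_mul (a * w₀))).add (((hasDerivAt_id x).pow 2).const_mul (a / 2)))
        refine e.congr_deriv ?_
        simp
        ring)
      (fun x hx => by
        have := lower hx.1 (hx.2.trans huw) hw₀δ
        rw [hw₀z] at this
        linarith)
    simp only [h0] at this
    linarith
  have hright : ∀ u, w₀ ≤ u → u < δ → G w₀ ≤ G u := by
    intro u hu hud
    refine le_of_hasDerivAt_nonneg (f' := G₁) hu (fun x hx => hG x (habs hw₀0.le hud hx)) ?_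
    intro x hx
    have := lower hw₀0.le hx.1 (hx.2.trans_lt hud)
    rw [hw₀z] at this
    nlinarith [hx.1]
  have hGw : G w₀ ≤ -(a * w₀ ^ 2 / 2) := by
    have := hleft w₀ hw₀0.le le_rfl
    nlinarith
  have hGw' : G w₀ < 0 := by
    have : 0 < a * w₀ ^ 2 / 2 := by positivity
    linarith
  -- From `G(u) ≥ -τu + au²/2`, which equals `3τ²/(2a)` at `u = 3τ/a`.
  have hu₁ : 0 < G (3 * τ / a) := by
    have := le_of_hasDerivAt_nonneg (f := fun u => G u + τ * u - a / 2 * u ^ 2)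
      (f' := fun u => G₁ u + τ - a * u) (show (0 : ℝ) ≤ 3 * τ / a by positivity)
      (fun x hx => by
        have e := (((hG x (habs le_rfl hδ hx)).add
          ((hasDerivAt_id x).const_mul τ)).sub (((hasDerivAt_id x).pow 2).const_mul (a / 2)))
        refine e.congr_deriv ?_
        simp
        ring)
      (fun x hx => by
        have := lower le_rfl hx.1 (hx.2.trans_lt hδ)
        rw [h1] at this
        linarith)
    simp only [h0] at this
    have e : a / 2 * (3 * τ / a) ^ 2 - τ * (3 * τ / a) = 3 / 2 * (τ ^ 2 / a) := by
      field_simp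
      ring
    have : 0 < τ ^ 2 / a := by positivity
    linarith
  have hw₁ : w₀ ≤ 3 * τ / a := by linarith [hw₀.2]
  obtain ⟨u₀, hu₀, hu₀z⟩ : ∃ u₀ ∈ Icc w₀ (3 * τ / a), G u₀ = 0 := by
    have hc : ContinuousOn G (Icc w₀ (3 * τ / a)) := fun u hu =>
      (hG u (habs hw₀0.le hδ hu)).continuousAt.continuousWithinAt
    exact intermediate_value_Icc hw₁ hc ⟨hGw'.le, hu₁.le⟩
  have hne : w₀ ≠ u₀ := by
    rintro rfl
    linarith
  refine ⟨w₀, u₀, hw₀0, lt_of_le_of_ne hu₀.1 hne, hu₀.2, hw₀z, hu₀z, ?_, huniq, hlow, hw₀.2, ?_, hGw⟩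
  · intro u hu huu
    rcases le_total u w₀ with h | h
    · have h2 := hleft u hu.le h
      have : 0 < a / 2 * (w₀ ^ 2 - (w₀ - u) ^ 2) := by
        have : 0 < w₀ ^ 2 - (w₀ - u) ^ 2 := by nlinarith
        positivity
      linarith
    · by_contra! hcon
      have hud : u₀ < δ := hu₀.2.trans_lt hδ
      -- strict increase from `u` to `u₀`
      have hlt : G u < G u₀ := by
        have hk : 0 < a * (u₀ - u) ^ 2 / 2 := by
          have : 0 < u₀ - u := by linarith
          positivity
        have := le_of_hasDerivAt_nonneg (f := fun x => G x - a / 2 * (x - u) ^ 2)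
          (f' := fun x => G₁ x - a * (x - u)) huu.le
          (fun x hx => by
            have e := (hG x (habs hu.le hud hx)).sub
              ((((hasDerivAt_id x).sub_const u).pow 2).const_mul (a / 2))
            refine e.congr_deriv ?_
            simp
            ring)
          (fun x hx => by
            have h4 := lower hw₀0.le (h.trans hx.1) (hx.2.trans_lt hud)
            rw [hw₀z] at h4
            nlinarith [hx.1])
        simp only [sub_self] at this
        linarith
      linarith
  · have := hleft (w₀ / 2) (by linarith) (by linarith)
    nlinarith

/-! ### The logarithm near `1`. -/

theorem one_sub_mem_slitPlane {x : ℂ} (hx : ‖x‖ < 1) : 1 - x ∈ slitPlane := by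
  rw [mem_slitPlane_iff]
  left
  have := (Complex.re_le_norm x).trans_lt hx
  simpa using this

theorem norm_log_one_sub_sub_le {q : ℝ} (hq : q < 1) {x y : ℂ} (hx : ‖x‖ ≤ q) (hy : ‖y‖ ≤ q) :
    ‖log (1 - x) - log (1 - y)‖ ≤ ‖x - y‖ / (1 - q) := by
  have hd : ∀ z ∈ Metric.closedBall (0 : ℂ) q, HasDerivWithinAt (fun z => log (1 - z))
      ((-1) / (1 - z)) (Metric.closedBall (0 : ℂ) q) z := by
    intro z hz
    rw [mem_closedBall_zero_iff] at hz
    exact (((hasDerivAt_id z).const_sub 1).clog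
      (one_sub_mem_slitPlane (hz.trans_lt hq))).hasDerivWithinAt
  have hb : ∀ z ∈ Metric.closedBall (0 : ℂ) q, ‖(-1) / (1 - z)‖ ≤ (1 - q)⁻¹ := by
    intro z hz
    rw [mem_closedBall_zero_iff] at hz
    rw [norm_div, norm_neg, norm_one, one_div]
    have := norm_sub_norm_le 1 z
    rw [norm_one] at this
    exact inv_anti₀ (by linarith) (by linarith)
  have := (convex_closedBall (0 : ℂ) q).norm_image_sub_le_of_norm_hasDerivWithin_le hd hb
    (mem_closedBall_zero_iff.2 hy) (mem_closedBall_zero_iff.2 hx)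
  rwa [inv_mul_eq_div] at this

theorem norm_log_one_sub_le {q : ℝ} (hq : q < 1) {x : ℂ} (hx : ‖x‖ ≤ q) :
    ‖log (1 - x)‖ ≤ ‖x‖ / (1 - q) := by
  simpa using norm_log_one_sub_sub_le hq hx (y := 0) (by simpa using (norm_nonneg x).trans hx)

/-! ### `J` as an integral over a vertical line. -/

/-- The integral of a function with Gaussian decay over the vertical lines `Re = 0`, `Re = -b`. -/
theorem integral_vertical_line_shift {F : ℂ → ℂ} {b K : ℝ} (hb : 0 ≤ b)
    (hF : ∀ w : ℂ, -b ≤ w.re → w.re ≤ 0 → DifferentiableAt ℂ F w)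
    (hK : ∀ x y : ℝ, -b ≤ x → x ≤ 0 → ‖F (x + y * I)‖ ≤ K * Real.exp (-y ^ 2)) :
    (∀ x : ℝ, -b ≤ x → x ≤ 0 → Integrable fun y : ℝ => F (x + y * I)) ∧
      ∫ y : ℝ, F (y * I) = ∫ y : ℝ, F (-b + y * I) := by
  have hint : ∀ x : ℝ, -b ≤ x → x ≤ 0 → Integrable fun y : ℝ => F (x + y * I) := by
    intro x h1 h2
    have hg : Integrable fun y : ℝ => K * Real.exp (-y ^ 2) := by
      simpa using (integrable_exp_neg_mul_sq one_pos).const_mul K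
    refine hg.mono' ?_ (Eventually.of_forall fun y => hK x y h1 h2)
    refine Continuous.aestronglyMeasurable (continuous_iff_continuousAt.2 fun y => ?_)
    refine ContinuousAt.comp (f := fun y : ℝ => (x : ℂ) + y * I) (hF _ ?_ ?_).continuousAt (by fun_prop)
    · simpa using h1
    · simpa using h2
  refine ⟨hint, ?_⟩
  have hlim : Tendsto (fun T : ℝ => K * Real.exp (-T ^ 2) * b) atTop (𝓝 0) := by
    have h1 : Tendsto (fun T : ℝ => Real.exp (-T ^ 2)) atTop (𝓝 0) :=
      Real.tendsto_exp_neg_atTop_nhds_zero.comp (tendsto_pow_atTop two_ne_zero)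
    simpa using (h1.const_mul K).mul_const b
  -- The horizontal sides of the rectangle, at heights `±T`, vanish in the limit.
  have hside : ∀ σ : ℝ, σ ^ 2 = 1 →
      Tendsto (fun T : ℝ => ∫ x : ℝ in (-b)..0, F (x + ((σ * T : ℝ) : ℂ) * I)) atTop (𝓝 0) := by
    intro σ hσ
    refine squeeze_zero_norm (fun T => ?_) hlim
    have := intervalIntegral.norm_integral_le_of_norm_le_const (a := -b) (b := 0)
      (f := fun x : ℝ => F (x + ((σ * T : ℝ) : ℂ) * I)) (C := K * Real.exp (-T ^ 2)) (by
        intro x hx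
        rw [uIoc_of_le (by linarith)] at hx
        have := hK x (σ * T) hx.1.le hx.2
        rwa [mul_pow, hσ, one_mul] at this)
    rwa [zero_sub, neg_neg, abs_of_nonneg hb] at this
  have hrect : ∀ T : ℝ, (∫ x : ℝ in (-b)..0, F (x + ((-1 * T : ℝ) : ℂ) * I)) -
      (∫ x : ℝ in (-b)..0, F (x + ((1 * T : ℝ) : ℂ) * I)) +
      I • (∫ y : ℝ in (-T)..T, F (((0 : ℝ) : ℂ) + y * I)) -
      I • (∫ y : ℝ in (-T)..T, F (((-b : ℝ) : ℂ) + y * I)) = 0 := by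
    intro T
    have := Complex.integral_boundary_rect_eq_zero_of_differentiableOn F ⟨-b, -T⟩ ⟨0, T⟩ (by
      intro w hw
      have h1 := hw.1
      simp only [mem_preimage, uIcc_of_le (show -b ≤ 0 by linarith)] at h1
      exact (hF w h1.1 h1.2).differentiableWithinAt)
    simpa only [neg_mul, one_mul] using this
  have h0 := intervalIntegral_tendsto_integral (hint 0 (by linarith) le_rfl) tendsto_neg_atTop_atBot
    tendsto_id
  have h1 := intervalIntegral_tendsto_integral (hint (-b) le_rfl (by linarith))
    tendsto_neg_atTop_atBot tendsto_id
  have h2 := ((((hside (-1) (by norm_num)).sub (hside 1 (by norm_num))).add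
    (h0.const_smul I)).sub (h1.const_smul I))
  have h3 := tendsto_nhds_unique (h2.congr fun T => hrect T) tendsto_const_nhds
  rw [sub_self, zero_add, sub_eq_zero] at h3
  have h4 := smul_right_injective ℂ Complex.I_ne_zero h3
  simpa using h4

/-- `J(d)` as an integral over a shifted line. -/
theorem J_eq_integral_line {B b : ℝ} {d : ℂ} (hB : 0 < B) (hb : 0 ≤ b)
    (hBb : B * Real.exp (b ^ 2) < 1) (hd : 0 < d.re) :
    (Integrable fun t : ℝ => log (1 - B * exp ((-b + t * I) ^ 2)) / (d - (-b + t * I))) ∧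
    J B d = (2 * Real.pi : ℂ)⁻¹ *
      ∫ t : ℝ, log (1 - B * exp ((-b + t * I) ^ 2)) / (d - (-b + t * I)) := by
  set q : ℝ := B * Real.exp (b ^ 2) with hq
  have hq1 : 0 < 1 - q := by linarith
  set F : ℂ → ℂ := fun w => log (1 - B * exp (w ^ 2)) / (d - w) with hFdef
  have hnorm : ∀ w : ℂ, ‖(B : ℂ) * exp (w ^ 2)‖ = B * Real.exp (w.re ^ 2 - w.im ^ 2) := by
    intro w
    rw [norm_mul, Complex.norm_real, Real.norm_of_nonneg hB.le, Complex.norm_exp]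
    congr 2
    simp [sq]
  have hsq : ∀ w : ℂ, -b ≤ w.re → w.re ≤ 0 → w.re ^ 2 ≤ b ^ 2 := by
    intro w h1 h2
    nlinarith
  have hnorm2 : ∀ w : ℂ, -b ≤ w.re → w.re ≤ 0 →
      ‖(B : ℂ) * exp (w ^ 2)‖ ≤ q * Real.exp (-w.im ^ 2) := by
    intro w h1 h2
    rw [hnorm, hq, mul_assoc, ← Real.exp_add]
    gcongr
    linarith [hsq w h1 h2]
  have hq0 : 0 < q := by positivity
  have hnorm3 : ∀ w : ℂ, -b ≤ w.re → w.re ≤ 0 → ‖(B : ℂ) * exp (w ^ 2)‖ ≤ q := by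
    intro w h1 h2
    refine (hnorm2 w h1 h2).trans (mul_le_of_le_one_right hq0.le ?_)
    rw [Real.exp_le_one_iff]
    nlinarith [sq_nonneg w.im]
  have hden : ∀ w : ℂ, w.re ≤ 0 → d.re ≤ ‖d - w‖ := by
    intro w hw
    refine le_trans ?_ (Complex.re_le_norm _)
    rw [Complex.sub_re]
    linarith
  have hdiff : ∀ w : ℂ, -b ≤ w.re → w.re ≤ 0 → DifferentiableAt ℂ F w := by
    intro w h1 h2
    have hs := one_sub_mem_slitPlane ((hnorm3 w h1 h2).trans_lt hBb)
    have hn : d - w ≠ 0 := norm_pos_iff.1 (hd.trans_le (hden w h2))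
    exact DifferentiableAt.div (DifferentiableAt.clog (by fun_prop) hs) (by fun_prop) hn
  have hbound : ∀ x y : ℝ, -b ≤ x → x ≤ 0 →
      ‖F (x + y * I)‖ ≤ q / (1 - q) / d.re * Real.exp (-y ^ 2) := by
    intro x y h1 h2
    have e1 : ((x : ℂ) + y * I).re = x := by simp
    have e2 : ((x : ℂ) + y * I).im = y := by simp
    rw [hFdef, norm_div]
    have l1 := norm_log_one_sub_le hBb (hnorm3 (x + y * I) (by rwa [e1]) (by rwa [e1]))
    have l2 := hnorm2 (x + y * I) (by rwa [e1]) (by rwa [e1])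
    rw [e2] at l2
    calc _ ≤ (q * Real.exp (-y ^ 2) / (1 - q)) / d.re := by
          gcongr
          · exact l1.trans (by gcongr)
          · exact hden _ (by rwa [e1])
      _ = _ := by ring
  obtain ⟨hint, hshift⟩ := integral_vertical_line_shift hb hdiff hbound
  have hint0 : Integrable fun y : ℝ => F (y * I) := by
    simpa using hint 0 (by linarith) le_rfl
  refine ⟨by simpa [hFdef] using hint (-b) le_rfl (by linarith), ?_⟩
  have hFb : ∫ t : ℝ, log (1 - B * exp ((-b + t * I) ^ 2)) / (d - (-b + t * I)) =
      ∫ y : ℝ, F (y * I) := hshift.symm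
  have hneg : ∫ y in Iic (0 : ℝ), F (y * I) = ∫ y in Ioi (0 : ℝ), F (((-y : ℝ) : ℂ) * I) := by
    have := integral_comp_neg_Ioi (0 : ℝ) (fun y : ℝ => F (y * I))
    rw [neg_zero] at this
    exact this.symm
  -- The logarithm is even in `y`, and `1/(d - iy) + 1/(d + iy) = 2d/(y² + d²)`.
  have hsum : ∫ y : ℝ, F (y * I) =
      ∫ y in Ioi (0 : ℝ), 2 * (d / ((y : ℂ) ^ 2 + d ^ 2) *
        ((Real.log (1 - B * Real.exp (-y ^ 2)) : ℝ) : ℂ)) := by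
    rw [← intervalIntegral.integral_Iic_add_Ioi hint0.integrableOn hint0.integrableOn, hneg,
      ← integral_add hint0.comp_neg.integrableOn hint0.integrableOn]
    refine integral_congr_ae (Eventually.of_forall fun y => ?_)
    have e1 : ((y : ℂ) * I) ^ 2 = ((-y ^ 2 : ℝ) : ℂ) := by
      rw [mul_pow, Complex.I_sq]; push_cast; ring
    have e2 : (((-y : ℝ) : ℂ) * I) ^ 2 = ((-y ^ 2 : ℝ) : ℂ) := by
      rw [mul_pow, Complex.I_sq]; push_cast; ring
    have hpos : 0 ≤ 1 - B * Real.exp (-y ^ 2) := by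
      have := hnorm3 (y * I) (by simpa using hb) (by simp)
      rw [e1, ← Complex.ofReal_exp, ← Complex.ofReal_mul, Complex.norm_real] at this
      linarith [(Real.le_norm_self _).trans this]
    have n1 : d - y * I ≠ 0 := norm_pos_iff.1 (hd.trans_le (hden _ (by simp)))
    have n2 : d + y * I ≠ 0 := by
      have := norm_pos_iff.1 (hd.trans_le (hden (((-y : ℝ) : ℂ) * I) (by simp)))
      simpa using this
    have n3 : (y : ℂ) ^ 2 + d ^ 2 = (d - y * I) * (d + y * I) := by
      linear_combination (y : ℂ) ^ 2 * Complex.I_sq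
    simp only [hFdef]
    rw [e1, e2, n3, Complex.ofReal_log hpos]
    push_cast
    rw [show d - -(y : ℂ) * I = d + y * I by ring]
    field_simp
    ring
  rw [hFb, hsum, J, integral_const_mul]
  have : (Real.pi : ℂ) ≠ 0 := by exact_mod_cast Real.pi_ne_zero
  field_simp

/-- `J(d)` over the line `Re v = -a` in the variable `v`, scaled by `κ`. -/
theorem J_eq_integral_scaled {B a κ : ℝ} {d : ℂ} (hB : 0 < B) (ha : 0 ≤ a) (hκ : 0 < κ)
    (hBb : B * Real.exp ((κ * a) ^ 2) < 1) (hd : 0 < d.re) :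
    (Integrable fun θ : ℝ =>
      log (1 - B * exp ((κ * (-a + θ * I)) ^ 2)) * (κ / (d - κ * (-a + θ * I)))) ∧
    J B d = (2 * Real.pi : ℂ)⁻¹ *
      ∫ θ : ℝ, log (1 - B * exp ((κ * (-a + θ * I)) ^ 2)) * (κ / (d - κ * (-a + θ * I))) := by
  obtain ⟨h1, h2⟩ := J_eq_integral_line hB (mul_nonneg hκ.le ha) hBb hd
  set f : ℝ → ℂ := fun t => log (1 - B * exp ((-((κ * a : ℝ) : ℂ) + t * I) ^ 2)) /
    (d - (-((κ * a : ℝ) : ℂ) + t * I)) with hf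
  have key : (fun θ : ℝ =>
      log (1 - B * exp ((κ * (-a + θ * I)) ^ 2)) * (κ / (d - κ * (-a + θ * I)))) =
      fun θ : ℝ => (κ : ℂ) * f (κ * θ) := by
    ext θ
    simp only [hf]
    have : (κ : ℂ) * (-a + θ * I) = -((κ * a : ℝ) : ℂ) + ((κ * θ : ℝ) : ℂ) * I := by
      push_cast; ring
    rw [this]
    ring
  rw [key]
  refine ⟨(h1.comp_mul_left' hκ.ne').const_mul _, ?_⟩
  rw [h2, integral_const_mul, Measure.integral_comp_mul_left f κ, abs_of_pos (inv_pos.2 hκ),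
    Complex.real_smul, ← mul_assoc (κ : ℂ), ← Complex.ofReal_mul, mul_inv_cancel₀ hκ.ne',
    Complex.ofReal_one, one_mul]

/-! ### Comparison of the kernels and of the integrands. -/

theorem norm_exp_sub_exp_le {M : ℝ} {a b : ℂ} (ha : a.re ≤ M) (hb : b.re ≤ M) :
    ‖exp a - exp b‖ ≤ Real.exp M * ‖a - b‖ := by
  refine (convex_halfSpace_re_le M).norm_image_sub_le_of_norm_hasDerivWithin_le
    (fun x _ => (Complex.hasDerivAt_exp x).hasDerivWithinAt) (fun x hx => ?_) hb ha
  rw [Complex.norm_exp]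
  exact Real.exp_le_exp.2 hx

theorem norm_exp_sub_one_le_of_re_nonpos {v : ℂ} (hv : v.re ≤ 0) : ‖exp v - 1‖ ≤ ‖v‖ := by
  simpa using norm_exp_sub_exp_le (M := 0) (a := v) (b := 0) hv (by simp)

theorem norm_exp_sub_one_sub_le_of_re_nonpos {v : ℂ} (hv : v.re ≤ 0) :
    ‖exp v - 1 - v‖ ≤ ‖v‖ ^ 2 := by
  have hconv : Convex ℝ ({w : ℂ | w.re ≤ 0} ∩ Metric.closedBall 0 ‖v‖) :=
    (convex_halfSpace_re_le 0).inter (convex_closedBall 0 ‖v‖)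
  have := hconv.norm_image_sub_le_of_norm_hasDerivWithin_le
    (f := fun w => exp w - 1 - w) (f' := fun w => exp w - 1) (C := ‖v‖) (x := 0) (y := v)
    (fun x _ => (((Complex.hasDerivAt_exp x).sub_const 1).sub (hasDerivAt_id x)).hasDerivWithinAt)
    (fun x hx => (norm_exp_sub_one_le_of_re_nonpos hx.1).trans (mem_closedBall_zero_iff.1 hx.2))
    ⟨by simp, by simp⟩ ⟨hv, by simp⟩
  simpa [sq] using this

/-- This is what the shift to the left buys: bounds free of `Z`. The first uses `|Z| ≥ e^{w₀}` and
`e^{w₀} - e^{w₀/2} ≥ w₀/2`; the second takes real parts. -/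
theorem kernel_denominators {w₀ : ℝ} (hw : 0 < w₀) {v Z : ℂ} (hv : v.re = -(w₀ / 2))
    (hZ : Real.exp w₀ ≤ ‖Z‖) (hZre : Real.exp w₀ < Z.re) :
    w₀ / 2 ≤ ‖Z - Real.exp w₀ * exp v‖ ∧
      w₀ / 2 ≤ ‖Z - Real.exp w₀ - Real.exp w₀ * v‖ := by
  have hz1 : 1 ≤ Real.exp w₀ := Real.one_le_exp hw.le
  constructor
  · have h1 : ‖(Real.exp w₀ : ℂ) * exp v‖ = Real.exp (w₀ / 2) := by
      rw [norm_mul, Complex.norm_real, Real.norm_of_nonneg (Real.exp_pos _).le, Complex.norm_exp, hv,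
        ← Real.exp_add]
      ring_nf
    have h2 := norm_sub_norm_le Z ((Real.exp w₀ : ℂ) * exp v)
    rw [h1] at h2
    have h3 : Real.exp w₀ = Real.exp (w₀ / 2) * Real.exp (w₀ / 2) := by
      rw [← Real.exp_add]; ring_nf
    have h4 := Real.add_one_le_exp (w₀ / 2)
    nlinarith
  · refine le_trans ?_ (Complex.re_le_norm _)
    rw [Complex.sub_re, Complex.sub_re, Complex.re_ofReal_mul, Complex.ofReal_re, hv]
    nlinarith

theorem kernel_bounds {w₀ : ℝ} (hw : 0 < w₀) (hw1 : w₀ ≤ 1) {v Z : ℂ} (hv : v.re = -(w₀ / 2))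
    (hZ : Real.exp w₀ ≤ ‖Z‖) (hZre : Real.exp w₀ < Z.re) :
    ‖Real.exp w₀ * exp v / (Z - Real.exp w₀ * exp v)‖ ≤ 6 / w₀ ∧
    ‖(Real.exp w₀ : ℂ) / (Z - Real.exp w₀ - Real.exp w₀ * v)‖ ≤ 6 / w₀ ∧
    ‖Real.exp w₀ * exp v / (Z - Real.exp w₀ * exp v) -
      (Real.exp w₀ : ℂ) / (Z - Real.exp w₀ - Real.exp w₀ * v)‖ ≤
        6 * (‖v‖ / w₀) + 36 * (‖v‖ / w₀) ^ 2 := by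
  obtain ⟨hD1, hD2⟩ := kernel_denominators hw hv hZ hZre
  have hw2 : 0 < w₀ / 2 := by linarith
  have hre : v.re ≤ 0 := by rw [hv]; linarith
  have hz3 : ‖(Real.exp w₀ : ℂ)‖ ≤ 3 := by
    rw [Complex.norm_real, Real.norm_of_nonneg (Real.exp_pos _).le]
    exact (Real.exp_le_exp.2 hw1).trans (by linarith [Real.exp_one_lt_d9])
  have hev : ‖exp v‖ ≤ 1 := by
    rw [Complex.norm_exp]
    exact Real.exp_le_one_iff.2 hre
  have hzev : ‖Real.exp w₀ * exp v‖ ≤ 3 := by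
    rw [norm_mul]
    nlinarith [norm_nonneg (exp v), norm_nonneg (Real.exp w₀ : ℂ)]
  have e1 := norm_exp_sub_one_le_of_re_nonpos hre
  have e2 := norm_exp_sub_one_sub_le_of_re_nonpos hre
  set z : ℂ := (Real.exp w₀ : ℂ)
  set D₁ : ℂ := Z - z * exp v with hD₁
  set D₂ : ℂ := Z - z - z * v with hD₂
  have n1 : D₁ ≠ 0 := norm_pos_iff.1 (hw2.trans_le hD1)
  have n2 : D₂ ≠ 0 := norm_pos_iff.1 (hw2.trans_le hD2)
  have h6 : 3 / (w₀ / 2) = 6 / w₀ := by field_simp; norm_num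
  refine ⟨?_, ?_, ?_⟩
  · rw [norm_div, ← h6]
    gcongr
  · rw [norm_div, ← h6]
    gcongr
  -- The denominators differ by `z(e^v - 1 - v)`, so the term with two of them carries a quadratic
  -- factor.
  · have key : z * exp v / D₁ - z / D₂ =
        z / D₂ * (exp v - 1) + (z * exp v / D₁) * (z / D₂) * (exp v - 1 - v) := by
      field_simp
      rw [hD₁, hD₂]
      ring
    rw [key]
    have b1 : ‖z * exp v / D₁‖ ≤ 6 / w₀ := by
      rw [norm_div, ← h6]
      gcongr
    have b2 : ‖z / D₂‖ ≤ 6 / w₀ := by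
      rw [norm_div, ← h6]
      gcongr
    calc _ ≤ ‖z / D₂‖ * ‖exp v - 1‖ + ‖z * exp v / D₁‖ * ‖z / D₂‖ * ‖exp v - 1 - v‖ := by
          refine (norm_add_le _ _).trans ?_
          rw [norm_mul, norm_mul, norm_mul]
      _ ≤ 6 / w₀ * ‖v‖ + 6 / w₀ * (6 / w₀) * ‖v‖ ^ 2 := by gcongr
      _ = _ := by ring

/-- The difference of products splits into (log difference) × (kernel of size `S`) plus (bounded
log) × (kernel difference). With `|v| ≤ A(1+y)/S` and `w₀ ≥ a₁/S` all powers of `S` cancel. -/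
theorem norm_log_mul_sub_le {q E a₁ S A M y : ℝ} (hq : q < 1) (ha₁ : 0 < a₁) (hS : 0 < S)
    (hM : 0 ≤ M) (hA : 0 ≤ A) (hy : 0 ≤ y) (hE0 : 0 ≤ E) (hE : E ≤ 1) {w₀ : ℝ} (hw : a₁ / S ≤ w₀)
    {v x₁ x₂ K₁ K₂ : ℂ} (hv : ‖v‖ ≤ A * (1 + y) / S) (hq0 : 0 ≤ q)
    (hx₁ : ‖x₁‖ ≤ q * E) (hx₂ : ‖x₂‖ ≤ q * E) (hx : ‖x₁ - x₂‖ ≤ M * S ^ 2 * ‖v‖ ^ 3 * E)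
    (hK₁ : ‖K₁‖ ≤ 6 / w₀) (hK : ‖K₁ - K₂‖ ≤ 6 * (‖v‖ / w₀) + 36 * (‖v‖ / w₀) ^ 2) :
    ‖log (1 - x₁) * K₁ - log (1 - x₂) * K₂‖ ≤
      (6 * M * A ^ 3 / a₁ + 6 * (A / a₁) + 36 * (A / a₁) ^ 2) / (1 - q) * ((1 + y) ^ 3 * E) := by
  have hq1 : 0 < 1 - q := by linarith
  have hw0 : 0 < w₀ := lt_of_lt_of_le (by positivity) hw
  have hx₁q : ‖x₁‖ ≤ q := hx₁.trans (mul_le_of_le_one_right hq0 hE)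
  have hx₂q : ‖x₂‖ ≤ q := hx₂.trans (mul_le_of_le_one_right hq0 hE)
  have l1 := norm_log_one_sub_sub_le hq hx₁q hx₂q
  have l2 := norm_log_one_sub_le hq hx₂q
  have hl2 : ‖log (1 - x₂)‖ ≤ E / (1 - q) := by
    refine l2.trans ?_
    gcongr
    exact hx₂.trans (mul_le_of_le_one_left hE0 hq.le)
  have hl1 : ‖log (1 - x₁) - log (1 - x₂)‖ ≤ M * S ^ 2 * (A * (1 + y) / S) ^ 3 * E / (1 - q) := by
    refine l1.trans ?_
    gcongr
    exact hx.trans (by gcongr)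
  have hK₁' : ‖K₁‖ ≤ 6 * S / a₁ := by
    refine hK₁.trans ?_
    calc 6 / w₀ ≤ 6 / (a₁ / S) := by gcongr
      _ = _ := by field_simp
  have hvw : ‖v‖ / w₀ ≤ A / a₁ * (1 + y) := by
    calc ‖v‖ / w₀ ≤ (A * (1 + y) / S) / (a₁ / S) := by gcongr
      _ = _ := by field_simp
  have hK' : ‖K₁ - K₂‖ ≤ 6 * (A / a₁ * (1 + y)) + 36 * (A / a₁ * (1 + y)) ^ 2 :=
    hK.trans (by gcongr)
  have hpow1 : (1 + y) ≤ (1 + y) ^ 3 := le_self_pow₀ (by linarith) (by norm_num)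
  have hpow2 : (1 + y) ^ 2 ≤ (1 + y) ^ 3 := pow_le_pow_right₀ (by linarith) (by norm_num)
  have hK'' : ‖K₁ - K₂‖ ≤ (6 * (A / a₁) + 36 * (A / a₁) ^ 2) * (1 + y) ^ 3 := by
    refine hK'.trans ?_
    calc _ = 6 * (A / a₁) * (1 + y) + 36 * (A / a₁) ^ 2 * (1 + y) ^ 2 := by ring
      _ ≤ 6 * (A / a₁) * (1 + y) ^ 3 + 36 * (A / a₁) ^ 2 * (1 + y) ^ 3 := by gcongr
      _ = _ := by ring
  calc _ = ‖(log (1 - x₁) - log (1 - x₂)) * K₁ + log (1 - x₂) * (K₁ - K₂)‖ := by congr 1; ring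
    _ ≤ ‖log (1 - x₁) - log (1 - x₂)‖ * ‖K₁‖ + ‖log (1 - x₂)‖ * ‖K₁ - K₂‖ := by
        refine (norm_add_le _ _).trans ?_
        rw [norm_mul, norm_mul]
    _ ≤ M * S ^ 2 * (A * (1 + y) / S) ^ 3 * E / (1 - q) * (6 * S / a₁) +
        E / (1 - q) * ((6 * (A / a₁) + 36 * (A / a₁) ^ 2) * (1 + y) ^ 3) := by gcongr
    _ = _ := by field_simp; ring

/-! ### From pointwise to integrated bounds. -/

theorem integrable_one_add_abs_pow_mul_exp {c : ℝ} (hc : 0 < c) :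
    Integrable fun y : ℝ => (1 + |y|) ^ 3 * Real.exp (-c * y ^ 2) := by
  have h1 := integrable_exp_neg_mul_sq hc
  have h2 : Integrable fun y : ℝ => y ^ 4 * Real.exp (-c * y ^ 2) := by
    have := integrable_rpow_mul_exp_neg_mul_sq hc (s := 4) (by norm_num)
    refine this.congr (Eventually.of_forall fun y => ?_)
    simp only
    norm_cast
  refine ((h1.add h2).const_mul 8).mono' (by fun_prop) (Eventually.of_forall fun y => ?_)
  rw [Real.norm_of_nonneg (by positivity)]
  have h3 : (1 + |y|) ^ 3 ≤ 8 * (1 + y ^ 4) := by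
    have h4 : y ^ 4 = |y| ^ 4 := by rw [← Even.pow_abs (by decide)]
    rw [h4]
    have := abs_nonneg y
    nlinarith [sq_nonneg (|y| - 1), sq_nonneg (|y| ^ 2 - 1), sq_nonneg (|y| ^ 2 - |y|), pow_nonneg this 3]
  calc _ ≤ 8 * (1 + y ^ 4) * Real.exp (-c * y ^ 2) := by gcongr
    _ = _ := by simp only [Pi.add_apply]; ring

/-- An integral over `[-π, π]` compared with one over the line, when the difference is dominated by
a Gaussian profile at scale `1 / S`. -/
theorem norm_integral_sub_integral_le {F₁ F₂ : ℝ → ℂ} {C c S : ℝ} (hc : 0 < c) (hS : 0 < S)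
    (hF₁ : IntegrableOn F₁ (Ioc (-Real.pi) Real.pi)) (hF₂ : Integrable F₂)
    (h1 : ∀ θ, |θ| ≤ Real.pi → ‖F₁ θ - F₂ θ‖ ≤
      C * ((1 + |S * θ|) ^ 3 * Real.exp (-c * (S * θ) ^ 2)))
    (h2 : ∀ θ, Real.pi ≤ |θ| → ‖F₂ θ‖ ≤ C * ((1 + |S * θ|) ^ 3 * Real.exp (-c * (S * θ) ^ 2))) :
    ‖(∫ θ in (-Real.pi)..Real.pi, F₁ θ) - ∫ θ, F₂ θ‖ ≤
      C * (∫ y : ℝ, (1 + |y|) ^ 3 * Real.exp (-c * y ^ 2)) / S := by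
  rw [intervalIntegral.integral_of_le (by linarith [Real.pi_pos]), ← integral_indicator measurableSet_Ioc,
    ← integral_sub ((integrable_indicator_iff measurableSet_Ioc).2 hF₁) hF₂]
  have hg := (((integrable_one_add_abs_pow_mul_exp hc).comp_mul_left' hS.ne').const_mul C)
  refine (norm_integral_le_of_norm_le hg (Eventually.of_forall fun θ => ?_)).trans_eq ?_
  · by_cases hθ : θ ∈ Ioc (-Real.pi) Real.pi
    · rw [indicator_of_mem hθ]
      exact h1 θ (abs_le.2 ⟨hθ.1.le, hθ.2⟩)
    · rw [indicator_of_notMem hθ, zero_sub, norm_neg]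
      refine h2 θ ?_
      by_contra! hcon
      exact hθ ⟨(abs_lt.1 hcon).1, (abs_lt.1 hcon).2.le⟩
  · rw [integral_const_mul,
      Measure.integral_comp_mul_left (fun y : ℝ => (1 + |y|) ^ 3 * Real.exp (-c * y ^ 2)) S,
      abs_of_pos (inv_pos.2 hS), smul_eq_mul]
    ring

/-! ### The integrand on circles and the move of the contour. -/

theorem pgfReal_exp_pow_eq (p : PMF ℕ) {n s : ℕ} {lam u : ℝ} (hn : (n : ℝ) = lam * s)
    (hu : ENNReal.ofReal (Real.exp u) < pgfRadius p) :
    pgfReal p (Real.exp u) ^ n =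
      Real.exp (s * (-u + lam * cgfReal p u)) * Real.exp u ^ s := by
  have hpos := pgfReal_pos p (Real.exp_pos u) hu
  have h1 : pgfReal p (Real.exp u) = Real.exp (cgfReal p u) := (Real.exp_log hpos).symm
  rw [h1, ← Real.exp_nat_mul, ← Real.exp_nat_mul, ← Real.exp_add, hn]
  ring_nf

/-- `D` is the gain from the angle: `D = 0` serves on the whole annulus and `D = -c₀θ²` on the
chosen circle. -/
theorem norm_demandPgf_div_le (p : PMF ℕ) {n s : ℕ} {lam u : ℝ} (hn : (n : ℝ) = lam * s)
    (hu : ENNReal.ofReal (Real.exp u) < pgfRadius p) {z : ℂ} (hz : ‖z‖ = Real.exp u) {D : ℝ}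
    (hD : ‖pgf p z‖ ≤ pgfReal p (Real.exp u) * Real.exp D) :
    ‖demandPgf p n z / z ^ s‖ ≤ Real.exp (s * (-u + lam * cgfReal p u) + n * D) := by
  rw [demandPgf, norm_div, norm_pow, norm_pow, hz, div_le_iff₀ (by positivity)]
  calc ‖pgf p z‖ ^ n ≤ (pgfReal p (Real.exp u) * Real.exp D) ^ n := by gcongr
    _ = _ := by
      rw [mul_pow, pgfReal_exp_pow_eq p hn hu, Real.exp_add, ← Real.exp_nat_mul D]
      ring

/-- The contour may be moved inside the annulus where `|z^{-s} A(z)| < 1`. -/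
theorem contourI_eq_integral {p : PMF ℕ} {n s : ℕ} {Z₀ ε ρ : ℝ} {Z : ℂ}
    (H : ∀ z : ℂ, 1 < ‖z‖ → ‖z‖ < Z₀ →
      ENNReal.ofReal ‖z‖ < pgfRadius p ∧ ‖demandPgf p n z / z ^ s‖ < 1)
    (hε : 0 < ε) (hεZ : 1 + ε < Z₀) (hρ : 1 < ρ) (hρZ : ρ < Z₀) (hZ : Z₀ ≤ ‖Z‖) :
    contourI p n s ε Z = (2 * Real.pi : ℂ)⁻¹ * ∫ θ in (-Real.pi)..Real.pi,
      log (1 - demandPgf p n (ρ * exp (θ * I)) / (ρ * exp (θ * I)) ^ s) *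
        (ρ * exp (θ * I) / (Z - ρ * exp (θ * I))) := by
  set f : ℂ → ℂ := fun z => log (1 - demandPgf p n z / z ^ s) / (Z - z) with hf
  have hd : ∀ z : ℂ, 1 < ‖z‖ → ‖z‖ < Z₀ → DifferentiableAt ℂ f z := by
    intro z h1 h2
    obtain ⟨hr, hlt⟩ := H z h1 h2
    have hz : z ≠ 0 := norm_pos_iff.1 (by linarith)
    have hZz : Z - z ≠ 0 := by
      rw [sub_ne_zero]
      rintro rfl
      linarith
    have hp := differentiableAt_pgf p hr
    have hA : DifferentiableAt ℂ (fun z => demandPgf p n z / z ^ s) z :=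
      (hp.pow n).div (differentiableAt_id.pow s) (pow_ne_zero s hz)
    exact ((hA.const_sub 1).clog (one_sub_mem_slitPlane hlt)).div (by fun_prop) hZz
  have hcircle : ∀ {r₁ r₂ : ℝ}, 1 < r₁ → r₁ ≤ r₂ → r₂ < Z₀ →
      (∮ z in C(0, r₂), f z) = ∮ z in C(0, r₁), f z := by
    intro r₁ r₂ h1 h12 h2
    refine Complex.circleIntegral_eq_of_differentiable_on_annulus_off_countable (by linarith) h12
      countable_empty (fun z hz => ?_) (fun z hz => ?_)
    · have a1 := hz.1
      have a2 := hz.2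
      rw [mem_closedBall_zero_iff] at a1
      rw [mem_ball_zero_iff, not_lt] at a2
      exact (hd z (by linarith) (by linarith)).continuousAt.continuousWithinAt
    · have a1 := hz.1.1
      have a2 := hz.1.2
      rw [mem_ball_zero_iff] at a1
      rw [mem_closedBall_zero_iff, not_le] at a2
      exact hd z (by linarith) (by linarith)
  have heq : (∮ z in C(0, 1 + ε), f z) = ∮ z in C(0, ρ), f z := by
    rcases le_total (1 + ε) ρ with h | h
    · exact (hcircle (by linarith) h hρZ).symm
    · exact hcircle hρ h hεZ
  -- Periodicity moves the angle from `[0, 2π]` to `[-π, π]`, centred at the saddle direction.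
  have hper : Function.Periodic (fun θ : ℝ => deriv (circleMap 0 ρ) θ • f (circleMap 0 ρ θ))
      (2 * Real.pi) := by
    intro θ
    simp only [deriv_circleMap, periodic_circleMap 0 ρ θ]
  have hper' := hper.intervalIntegral_add_eq 0 (-Real.pi)
  rw [zero_add, show -Real.pi + 2 * Real.pi = Real.pi by ring] at hper'
  rw [contourI]
  change _ * (∮ z in C(0, 1 + ε), f z) = _
  rw [heq, circleIntegral, hper']
  have hpt : ∀ θ : ℝ, deriv (circleMap 0 ρ) θ • f (circleMap 0 ρ θ) =
      I * (log (1 - demandPgf p n (ρ * exp (θ * I)) / (ρ * exp (θ * I)) ^ s) *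
        (ρ * exp (θ * I) / (Z - ρ * exp (θ * I)))) := by
    intro θ
    rw [deriv_circleMap, circleMap_zero, smul_eq_mul, hf]
    ring
  simp only [hpt]
  rw [intervalIntegral.integral_const_mul, ← mul_assoc]
  congr 1
  rw [mul_inv, mul_assoc, inv_mul_cancel₀ Complex.I_ne_zero, mul_one]

/-! ### The uniform saddle point estimate. -/

set_option maxHeartbeats 1000000 in
/-- The integral over the circle through `e^{w₀/2}` compared with `J`, uniformly in the saddle
point `e^{w₀}` at distance of order `1 / S` from `1`, where `S = √s`. -/
theorem CgfControl.exists_norm_integral_sub_J_le {p : PMF ℕ} {δ m M : ℝ} {ψ₁ ψ₂ : ℝ → ℝ}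
    (hψ : CgfControl p δ m M ψ₁ ψ₂) {c₀ l a₁ a₂ : ℝ} (hc₀ : 0 < c₀)
    (hdecay : ∀ ρ θ : ℝ, 1 ≤ ρ → ρ ≤ Real.exp δ → |θ| ≤ Real.pi →
      ‖pgf p (ρ * exp (θ * I))‖ ≤ pgfReal p ρ * Real.exp (-c₀ * θ ^ 2))
    (hl : 0 < l) (ha₁ : 0 < a₁) (ha₂ : 0 < a₂) :
    ∃ C : ℝ, ∀ (s n : ℕ) (S lam w₀ r : ℝ) (Z : ℂ), 1 ≤ S → S ^ 2 = s → (n : ℝ) = lam * s →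
      l ≤ lam → lam ≤ 2 * l → a₁ / S ≤ w₀ → w₀ ≤ a₂ / S → w₀ < δ / 4 → lam * ψ₁ w₀ = 1 →
      -(w₀ / 2) + lam * cgfReal p (w₀ / 2) ≤ -(3 / 8 * (lam * m) * w₀ ^ 2) →
      -w₀ + lam * cgfReal p w₀ ≤ -(lam * m * w₀ ^ 2 / 2) →
      0 < r → Real.exp w₀ ^ 2 * r ^ 2 = s * (lam * ψ₂ w₀) / 2 →
      Real.exp w₀ ≤ ‖Z‖ → Real.exp w₀ < Z.re →
      ‖(2 * Real.pi : ℂ)⁻¹ * (∫ θ in (-Real.pi)..Real.pi,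
        log (1 - demandPgf p n ((Real.exp (w₀ / 2) : ℝ) * exp (θ * I)) /
          ((Real.exp (w₀ / 2) : ℝ) * exp (θ * I)) ^ s) *
        ((Real.exp (w₀ / 2) : ℝ) * exp (θ * I) / (Z - (Real.exp (w₀ / 2) : ℝ) * exp (θ * I)))) -
        J (Real.exp (s * (-w₀ + lam * cgfReal p w₀))) ((Z - (Real.exp w₀ : ℝ)) * (r : ℂ))‖ ≤
      C / S := by
  have hδ0 := hψ.radius_pos
  have hδ1 := hψ.radius_le
  have hm := hψ.m_pos
  have hM := hψ.M_nonneg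
  -- At `θ = 0` both exponents are at most `-sλm w₀²/4`, hence at most `-q'`, by `λ ≥ l` and `w₀ ≥
  -- a₁/S`.
  set q' : ℝ := l * m * a₁ ^ 2 / 4 with hq'
  have hq'0 : 0 < q' := by positivity
  set q : ℝ := Real.exp (-q') with hq
  have hq0 : 0 < q := Real.exp_pos _
  have hq1 : q < 1 := Real.exp_lt_one_iff.2 (by linarith)
  have hq1' : 0 < 1 - q := by linarith
  -- A common Gaussian rate: `c₀ l` from the decay of `X`, and `lm/2` from `κ² ≥ s l m/2`.
  set c : ℝ := min (c₀ * l) (l * m / 2) with hc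
  have hc0 : 0 < c := lt_min (by positivity) (by positivity)
  set A : ℝ := a₂ + 1 with hA
  have hA1 : 1 ≤ A := by linarith
  -- The first summand is the Taylor remainder multiplied by `n ≤ 2l S²`; the second covers `|θ| >
  -- δ/4`, where only the trivial bound and `|v| > δ/4` are available.
  set M' : ℝ := 2 * l * M + 2 * (4 / δ) ^ 3 with hM'
  have hM'0 : 0 ≤ M' := by positivity
  set C₀ : ℝ := (6 * M' * A ^ 3 / a₁ + 6 * (A / a₁) + 36 * (A / a₁) ^ 2) / (1 - q) with hC₀
  set Q : ℝ := ∫ y : ℝ, (1 + |y|) ^ 3 * Real.exp (-c * y ^ 2) with hQ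
  refine ⟨(2 * Real.pi)⁻¹ * (C₀ * Q), ?_⟩
  intro s n S lam w₀ r Z hS1 hSs hn hlam1 hlam2 hw1 hw2 hwδ hsp hG1 hG2 hr hrη hZ hZre
  have hS0 : 0 < S := by linarith
  have hs0 : (0 : ℝ) < s := by rw [← hSs]; positivity
  have hlam0 : 0 < lam := by linarith
  have hw0 : 0 < w₀ := lt_of_lt_of_le (by positivity) hw1
  have hw₀1 : w₀ ≤ 1 := by linarith
  have hsw : a₁ ^ 2 ≤ s * w₀ ^ 2 := by
    have : a₁ ≤ w₀ * S := by rwa [div_le_iff₀ hS0] at hw1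
    calc a₁ ^ 2 ≤ (w₀ * S) ^ 2 := by gcongr
      _ = _ := by rw [mul_pow, hSs]; ring
  have hψ2l := hψ.le_second w₀ (by rw [abs_of_pos hw0]; linarith)
  have hψ2u := hψ.second_le w₀ (by rw [abs_of_pos hw0]; linarith)
  have hq'le : q' ≤ s * (lam * m * w₀ ^ 2 / 4) := by
    calc q' = l * m * a₁ ^ 2 / 4 := rfl
      _ ≤ lam * m * (s * w₀ ^ 2) / 4 := by gcongr
      _ = _ := by ring
  set z₀ : ℝ := Real.exp w₀ with hz₀
  have hz₀0 : 0 < z₀ := Real.exp_pos _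
  set κ : ℝ := z₀ * r with hκ
  have hκ0 : 0 < κ := mul_pos hz₀0 hr
  have hκ2 : κ ^ 2 = s * (lam * ψ₂ w₀) / 2 := by rw [hκ, mul_pow, hrη]
  have hκu : κ ^ 2 ≤ s * (lam * m) := by
    rw [hκ2]
    have : s * (lam * ψ₂ w₀) ≤ s * (lam * (2 * m)) := by gcongr
    linarith
  have hκl : s * (l * m) / 2 ≤ κ ^ 2 := by
    rw [hκ2]
    gcongr
  set B : ℝ := Real.exp (s * (-w₀ + lam * cgfReal p w₀)) with hB
  have hB0 : 0 < B := Real.exp_pos _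
  -- The shift by `w₀/2` costs at most `sλm w₀²/4`, half of what `s G(w₀)` provides.
  have hBexp : s * (-w₀ + lam * cgfReal p w₀) + κ ^ 2 * (w₀ / 2) ^ 2 ≤ -q' := by
    have h1 : s * (-w₀ + lam * cgfReal p w₀) ≤ s * (-(lam * m * w₀ ^ 2 / 2)) := by gcongr
    have h2 : κ ^ 2 * (w₀ / 2) ^ 2 ≤ s * (lam * m) * (w₀ / 2) ^ 2 := by gcongr
    linarith
  have hBb : B * Real.exp ((κ * (w₀ / 2)) ^ 2) < 1 := by
    rw [hB, ← Real.exp_add, mul_pow]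
    exact Real.exp_lt_one_iff.2 (by linarith)
  set d : ℂ := (Z - z₀) * (r : ℂ) with hd
  have hdre : 0 < d.re := by
    rw [hd, Complex.re_mul_ofReal, Complex.sub_re, Complex.ofReal_re]
    exact mul_pos (by linarith) hr
  obtain ⟨hJint, hJ⟩ := J_eq_integral_scaled hB0 (by linarith : (0 : ℝ) ≤ w₀ / 2) hκ0 hBb hdre
  -- common parametrisation
  set v : ℝ → ℂ := fun θ => -((w₀ / 2 : ℝ) : ℂ) + θ * I with hv
  have hvre : ∀ θ, (v θ).re = -(w₀ / 2) := fun θ => by simp [hv]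
  have hvim : ∀ θ, (v θ).im = θ := fun θ => by simp [hv]
  have hzv : ∀ θ : ℝ, ((Real.exp (w₀ / 2) : ℝ) : ℂ) * exp (θ * I) = (z₀ : ℂ) * exp (v θ) := by
    intro θ
    rw [hz₀, Complex.ofReal_exp, Complex.ofReal_exp, ← Complex.exp_add, ← Complex.exp_add]
    congr 1
    simp only [hv]
    push_cast
    ring
  have hK2 : ∀ θ : ℝ, (κ : ℂ) / (d - κ * (-((w₀ / 2 : ℝ) : ℂ) + θ * I)) =
      (z₀ : ℂ) / (Z - z₀ - z₀ * v θ) := by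
    intro θ
    have hr' : (r : ℂ) ≠ 0 := by exact_mod_cast hr.ne'
    rw [← mul_div_mul_left (z₀ : ℂ) (Z - z₀ - z₀ * v θ) hr', hd, hκ, hv]
    push_cast
    congr 1 <;> ring
  simp only [hK2] at hJint hJ
  rw [hJ, ← mul_sub, norm_mul]
  have hnormπ : ‖(2 * Real.pi : ℂ)⁻¹‖ = (2 * Real.pi)⁻¹ := by
    rw [norm_inv, norm_mul, Complex.norm_real, Real.norm_of_nonneg Real.pi_pos.le]
    norm_num
  rw [hnormπ, mul_div_assoc]
  refine mul_le_mul_of_nonneg_left ?_ (by positivity)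
  simp only [hzv]
  set x₁ : ℝ → ℂ := fun θ => demandPgf p n (z₀ * exp (v θ)) / (z₀ * exp (v θ)) ^ s with hx₁
  set x₂ : ℝ → ℂ := fun θ => B * exp ((κ * (-((w₀ / 2 : ℝ) : ℂ) + θ * I)) ^ 2) with hx₂
  set E : ℝ → ℝ := fun θ => Real.exp (-c * (S * θ) ^ 2) with hE
  have hE0 : ∀ θ, 0 ≤ E θ := fun θ => (Real.exp_pos _).le
  have hE1 : ∀ θ, E θ ≤ 1 := fun θ => by
    exact Real.exp_le_one_iff.2
      (mul_nonpos_of_nonpos_of_nonneg (neg_nonpos.2 hc0.le) (sq_nonneg _))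
  have hqE : ∀ θ, q * E θ = Real.exp (-q' - c * (S * θ) ^ 2) := fun θ => by
    rw [hq, hE, ← Real.exp_add]; ring_nf
  have hρrad : ∀ u, u ≤ δ → ENNReal.ofReal (Real.exp u) < pgfRadius p := fun u hu =>
    ofReal_lt_pgfRadius_of_le (Real.exp_le_exp.2 hu) hψ.lt_radius
  have hnormz : ∀ θ, ‖(z₀ : ℂ) * exp (v θ)‖ = Real.exp (w₀ / 2) := by
    intro θ
    rw [← hzv, norm_mul, Complex.norm_exp_ofReal_mul_I, mul_one, Complex.norm_real,
      Real.norm_of_nonneg (Real.exp_pos _).le]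
  have hx₁b : ∀ θ, |θ| ≤ Real.pi → ‖x₁ θ‖ ≤ q * E θ := by
    intro θ hθ
    have h1 := hdecay (Real.exp (w₀ / 2)) θ (Real.one_le_exp (by linarith))
      (Real.exp_le_exp.2 (by linarith)) hθ
    rw [hzv] at h1
    refine (norm_demandPgf_div_le p hn (hρrad _ (by linarith)) (hnormz θ) h1).trans ?_
    rw [hqE]
    apply Real.exp_le_exp.2
    have h2 : s * (-(w₀ / 2) + lam * cgfReal p (w₀ / 2)) ≤ s * (-(3 / 8 * (lam * m) * w₀ ^ 2)) := by
      gcongr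
    have h3 : c * (S * θ) ^ 2 ≤ n * (c₀ * θ ^ 2) := by
      calc c * (S * θ) ^ 2 = c * s * θ ^ 2 := by rw [mul_pow, hSs]; ring
        _ ≤ (c₀ * lam) * s * θ ^ 2 := by
          gcongr
          exact (min_le_left _ _).trans (by gcongr)
        _ = _ := by rw [hn]; ring
    have h4 : 0 ≤ s * (lam * m * w₀ ^ 2) := by positivity
    linarith
  have hx₂b : ∀ θ, ‖x₂ θ‖ ≤ q * E θ := by
    intro θ
    have e : ((κ : ℂ) * (-((w₀ / 2 : ℝ) : ℂ) + θ * I)) ^ 2 = ((κ ^ 2 : ℝ) : ℂ) * v θ ^ 2 := by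
      rw [mul_pow, Complex.ofReal_pow]
    rw [hqE]
    simp only [hx₂]
    rw [norm_mul, Complex.norm_real, Real.norm_of_nonneg hB0.le, Complex.norm_exp, e,
      Complex.re_ofReal_mul, hB, ← Real.exp_add]
    apply Real.exp_le_exp.2
    have h1 : (v θ ^ 2).re = (w₀ / 2) ^ 2 - θ ^ 2 := by
      rw [sq, Complex.mul_re, hvre, hvim]; ring
    rw [h1, mul_sub]
    have h3 : c * (S * θ) ^ 2 ≤ κ ^ 2 * θ ^ 2 := by
      calc c * (S * θ) ^ 2 = s * c * θ ^ 2 := by rw [mul_pow, hSs]; ring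
        _ ≤ (s * (l * m / 2)) * θ ^ 2 := by
          gcongr
          exact min_le_right _ _
        _ ≤ κ ^ 2 * θ ^ 2 := by
          gcongr
          linarith
    linarith
  have hvθ : ∀ θ, |θ| ≤ ‖v θ‖ := fun θ => by
    have := Complex.abs_im_le_norm (v θ)
    rwa [hvim] at this
  have hvnorm : ∀ θ, ‖v θ‖ ≤ w₀ / 2 + |θ| := fun θ => by
    have := Complex.norm_le_abs_re_add_abs_im (v θ)
    rwa [hvim, hvre, abs_neg, abs_of_pos (by linarith : 0 < w₀ / 2)] at this
  have hvA : ∀ θ, ‖v θ‖ ≤ A * (1 + |S * θ|) / S := fun θ => by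
    refine (hvnorm θ).trans ?_
    rw [le_div_iff₀ hS0, abs_mul, abs_of_pos hS0, hA]
    have h1 : w₀ * S ≤ a₂ := by rwa [le_div_iff₀ hS0] at hw2
    have h2 : 0 ≤ S * |θ| := by positivity
    have h3 : 0 ≤ a₂ * (S * |θ|) := by positivity
    linarith
  have hx₁₂ : ∀ θ, |θ| ≤ Real.pi → ‖x₁ θ - x₂ θ‖ ≤ M' * S ^ 2 * ‖v θ‖ ^ 3 * E θ := by
    intro θ hθ
    rcases le_or_gt |θ| (δ / 4) with h | h
    · have hwv : w₀ + ‖v θ‖ < δ := by linarith [hvnorm θ]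
      have hwv' : ‖(w₀ : ℂ) + v θ‖ < δ := by
        refine (norm_add_le _ _).trans_lt ?_
        rwa [Complex.norm_real, Real.norm_of_nonneg hw0.le]
      set E₁ : ℂ := n * cgf p (w₀ + v θ) - s * (w₀ + v θ) with hE₁
      set E₂ : ℂ := ((s * (-w₀ + lam * cgfReal p w₀) : ℝ) : ℂ) + ((κ ^ 2 : ℝ) : ℂ) * v θ ^ 2 with hE₂
      have e1 : x₁ θ = exp E₁ := by
        simp only [hx₁]
        rw [hE₁, Complex.exp_sub, Complex.exp_nat_mul, Complex.exp_nat_mul, hψ.exp_cgf _ hwv',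
          demandPgf, hz₀, Complex.ofReal_exp, ← Complex.exp_add]
      have e2 : x₂ θ = exp E₂ := by
        simp only [hx₂]
        rw [hE₂, Complex.exp_add, hB, Complex.ofReal_exp]
        congr 2
        simp only [hv]
        push_cast
        ring
      have hre : ∀ X : ℂ, ‖exp X‖ ≤ q * E θ → X.re ≤ -q' - c * (S * θ) ^ 2 := by
        intro X hX
        rwa [Complex.norm_exp, hqE, Real.exp_le_exp] at hX
      have h1 := norm_exp_sub_exp_le (hre E₁ (e1 ▸ hx₁b θ hθ)) (hre E₂ (e2 ▸ hx₂b θ))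
      rw [← e1, ← e2, ← hqE] at h1
      -- The linear terms cancel by the saddle equation `λψ₁(w₀) = 1`, and `κ²` matches the
      -- quadratic one, leaving `n` times the cubic remainder.
      have hdiff : E₁ - E₂ = n * (cgf p (w₀ + v θ) - cgfReal p w₀ - ψ₁ w₀ * v θ -
          ψ₂ w₀ * v θ ^ 2 / 2) := by
        have hnC : (n : ℂ) = (lam : ℂ) * s := by exact_mod_cast congrArg (Complex.ofReal) hn
        have hspC : (lam : ℂ) * ψ₁ w₀ = 1 := by exact_mod_cast congrArg (Complex.ofReal) hsp
        rw [hE₁, hE₂, hκ2]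
        push_cast
        linear_combination (cgfReal p w₀ + ψ₁ w₀ * v θ + ψ₂ w₀ * v θ ^ 2 / 2) * hnC +
          (s : ℂ) * v θ * hspC
      have ht := hψ.taylor w₀ (v θ) (by rwa [abs_of_pos hw0])
      have h2 : ‖E₁ - E₂‖ ≤ 2 * l * S ^ 2 * (M * ‖v θ‖ ^ 3) := by
        rw [hdiff, norm_mul, Complex.norm_natCast]
        gcongr
        rw [hn, hSs]
        gcongr
      calc ‖x₁ θ - x₂ θ‖ ≤ q * E θ * ‖E₁ - E₂‖ := h1
        _ ≤ 1 * E θ * (2 * l * S ^ 2 * (M * ‖v θ‖ ^ 3)) := by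
          have := hE0 θ
          gcongr
        _ = 2 * l * M * S ^ 2 * ‖v θ‖ ^ 3 * E θ := by ring
        _ ≤ _ := by
          have := hE0 θ
          gcongr
          rw [hM']
          have : 0 ≤ 2 * (4 / δ) ^ 3 := by positivity
          linarith
    · have h1 : 1 ≤ S ^ 2 * ((4 / δ) ^ 3 * ‖v θ‖ ^ 3) := by
        rw [← mul_pow]
        have h2 : 1 ≤ 4 / δ * ‖v θ‖ := by
          have := hvθ θ
          calc (1 : ℝ) = 4 / δ * (δ / 4) := by field_simp
            _ ≤ 4 / δ * ‖v θ‖ := by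
              gcongr
              linarith
        exact one_le_mul_of_one_le_of_one_le (one_le_pow₀ hS1) (one_le_pow₀ h2)
      have hE0θ := hE0 θ
      calc ‖x₁ θ - x₂ θ‖ ≤ q * E θ + q * E θ :=
            (norm_sub_le _ _).trans (add_le_add (hx₁b θ hθ) (hx₂b θ))
        _ ≤ 1 * E θ + 1 * E θ := by gcongr
        _ = 2 * 1 * E θ := by ring
        _ ≤ 2 * (S ^ 2 * ((4 / δ) ^ 3 * ‖v θ‖ ^ 3)) * E θ := by gcongr
        _ = 2 * (4 / δ) ^ 3 * S ^ 2 * ‖v θ‖ ^ 3 * E θ := by ring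
        _ ≤ _ := by
          gcongr
          rw [hM']
          have : 0 ≤ 2 * l * M := by positivity
          linarith
  have hker : ∀ θ, _ := fun θ => kernel_bounds hw0 hw₀1 (hvre θ) hZ hZre
  refine norm_integral_sub_integral_le hc0 hS0 ?_ hJint ?_ ?_
  · -- continuity of the integrand on the circle
    refine (ContinuousOn.integrableOn_Icc ?_).mono_set Ioc_subset_Icc_self
    intro θ hθ
    have hθ' : |θ| ≤ Real.pi := abs_le.2 hθ
    have hvc : Continuous v := by simp only [hv]; fun_prop
    have hzc : ContinuousAt (fun θ => (z₀ : ℂ) * exp (v θ)) θ := by fun_prop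
    have hpc : ContinuousAt (fun θ => pgf p ((z₀ : ℂ) * exp (v θ))) θ :=
      ContinuousAt.comp (f := fun θ => (z₀ : ℂ) * exp (v θ))
        (differentiableAt_pgf p (by rw [hnormz]; exact hρrad _ (by linarith))).continuousAt hzc
    have hzne : (z₀ : ℂ) * exp (v θ) ≠ 0 := norm_pos_iff.1 (by rw [hnormz]; exact Real.exp_pos _)
    have hxc : ContinuousAt x₁ θ := (hpc.pow n).div (hzc.pow s) (pow_ne_zero s hzne)
    have hDne : Z - (z₀ : ℂ) * exp (v θ) ≠ 0 :=
      norm_pos_iff.1 (lt_of_lt_of_le (by linarith) (kernel_denominators hw0 (hvre θ) hZ hZre).1)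
    have hlt : ‖x₁ θ‖ < 1 := by
      exact ((hx₁b θ hθ').trans (mul_le_of_le_one_right hq0.le (hE1 θ))).trans_lt hq1
    exact (((continuousAt_const.sub hxc).clog (one_sub_mem_slitPlane hlt)).mul
      (hzc.div (continuousAt_const.sub hzc) hDne)).continuousWithinAt
  · intro θ hθ
    exact norm_log_mul_sub_le hq1 ha₁ hS0 hM'0 (by linarith) (abs_nonneg _) (hE0 θ) (hE1 θ) hw1
      (hvA θ) hq0.le (hx₁b θ hθ) (hx₂b θ) (hx₁₂ θ hθ) (hker θ).1 (hker θ).2.2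
  · intro θ hθ
    have hE0θ := hE0 θ
    have hl2 : ‖log (1 - x₂ θ)‖ ≤ E θ / (1 - q) := by
      refine (norm_log_one_sub_le hq1 ((hx₂b θ).trans
        (mul_le_of_le_one_right hq0.le (hE1 θ)))).trans ?_
      gcongr
      exact (hx₂b θ).trans (mul_le_of_le_one_left hE0θ hq1.le)
    have hSy : S ≤ |S * θ| := by
      rw [abs_mul, abs_of_pos hS0]
      exact le_mul_of_one_le_right hS0.le (by linarith [Real.pi_gt_three])
    have hpow1 : |S * θ| ≤ (1 + |S * θ|) ^ 3 :=
      (by linarith [abs_nonneg (S * θ)] : |S * θ| ≤ 1 + |S * θ|).trans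
        (le_self_pow₀ (by linarith [abs_nonneg (S * θ)]) (by norm_num))
    have hk : ‖(z₀ : ℂ) / (Z - z₀ - z₀ * v θ)‖ ≤ 6 * (A / a₁) * (1 + |S * θ|) ^ 3 := by
      calc _ ≤ 6 / w₀ := (hker θ).2.1
        _ ≤ 6 / (a₁ / S) := by gcongr
        _ = 6 * (1 / a₁) * S := by field_simp
        _ ≤ 6 * (A / a₁) * (1 + |S * θ|) ^ 3 := by
          gcongr
          exact hSy.trans hpow1
    rw [norm_mul]
    calc _ ≤ E θ / (1 - q) * (6 * (A / a₁) * (1 + |S * θ|) ^ 3) := by gcongr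
      _ = (6 * (A / a₁)) / (1 - q) * ((1 + |S * θ|) ^ 3 * E θ) := by ring
      _ ≤ C₀ * ((1 + |S * θ|) ^ 3 * E θ) := by
        rw [hC₀]
        gcongr
        have h1 : 0 ≤ 6 * M' * A ^ 3 / a₁ := by positivity
        have h2 : 0 ≤ 36 * (A / a₁) ^ 2 := by positivity
        linarith

/-! ### Translation between `g` and the variable `ln x`. -/

theorem IsAdmissible.mean_pos {p : PMF ℕ} (hp : IsAdmissible p) : 0 < mean p := by
  obtain ⟨R, h1, h2, h3⟩ := exists_gt_ofReal_lt_pgfRadius (p := p) (x := 1)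
    (by simpa using hp.one_lt_radius)
  have hs := (Complex.hasSum_deriv_of_summable_norm (z := 1) (summable_toReal_mul_pow p h2.le h3)
    (F := fun k w => ((p k).toReal : ℂ) * w ^ k) (U := Metric.ball 0 R)
    (fun i => by fun_prop) Metric.isOpen_ball (fun i w hw => pgf_term_bound p i w hw)
    (by simpa)).summable
  have hs' : Summable fun k : ℕ => (k : ℝ) * (p k).toReal := by
    rw [← Complex.summable_ofReal]
    refine hs.congr fun k => ?_
    simp [mul_comm]
  obtain ⟨j, k, hjk, -, hk⟩ := hp.exists_lt_pos
  have hk0 : (0 : ℝ) < k := by exact_mod_cast (by omega : 0 < k)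
  exact hs'.tsum_pos (fun i => by positivity) k (by positivity)

theorem g_eq_comp_log (p : PMF ℕ) (n s : ℕ) {x : ℝ} (hx : 0 < x) :
    g p n s x = -Real.log x + (n : ℝ) / s * cgfReal p (Real.log x) := by
  rw [g, cgfReal, Real.exp_log hx]

/-- `ln x` lies within `δ` of `0`. -/
theorem eventually_abs_log_lt {δ x : ℝ} (hx : 0 < x) (h : |Real.log x| < δ) :
    ∀ᶠ y in 𝓝 x, 0 < y ∧ |Real.log y| < δ :=
  (eventually_gt_nhds hx).and
    ((Real.continuousAt_log hx.ne').abs.eventually_lt_const h)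

theorem CgfControl.hasDerivAt_g {p : PMF ℕ} {δ m M : ℝ} {ψ₁ ψ₂ : ℝ → ℝ}
    (hψ : CgfControl p δ m M ψ₁ ψ₂) (n s : ℕ) {x : ℝ} (hx : 0 < x) (h : |Real.log x| < δ) :
    HasDerivAt (g p n s) ((-1 + (n : ℝ) / s * ψ₁ (Real.log x)) * x⁻¹) x := by
  have h1 : HasDerivAt (fun u : ℝ => -u + (n : ℝ) / s * cgfReal p u)
      (-1 + (n : ℝ) / s * ψ₁ (Real.log x)) (Real.log x) :=
    (hasDerivAt_id _).neg.add ((hψ.hasDerivAt _ h).const_mul _)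
  refine (h1.comp x (Real.hasDerivAt_log hx.ne')).congr_of_eventuallyEq ?_
  filter_upwards [eventually_gt_nhds hx] with y hy
  exact g_eq_comp_log p n s hy

/-- At a critical point the term from differentiating `1/x` drops out. -/
theorem CgfControl.saddleEta_eq {p : PMF ℕ} {δ m M : ℝ} {ψ₁ ψ₂ : ℝ → ℝ}
    (hψ : CgfControl p δ m M ψ₁ ψ₂) (n s : ℕ) {w₀ : ℝ} (h : |w₀| < δ)
    (hsp : -1 + (n : ℝ) / s * ψ₁ w₀ = 0) :
    saddleEta p n s (Real.exp w₀) = (n : ℝ) / s * ψ₂ w₀ / Real.exp w₀ ^ 2 := by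
  have hx := Real.exp_pos w₀
  have hlog : Real.log (Real.exp w₀) = w₀ := Real.log_exp w₀
  have h1 : HasDerivAt (fun u : ℝ => -1 + (n : ℝ) / s * ψ₁ u) ((n : ℝ) / s * ψ₂ w₀)
      (Real.log (Real.exp w₀)) := by
    rw [hlog]
    exact ((hψ.hasDerivAt' _ h).const_mul _).const_add _
  have h2 := (h1.comp (Real.exp w₀) (Real.hasDerivAt_log hx.ne')).mul (hasDerivAt_inv hx.ne')
  have h3 : deriv (g p n s) =ᶠ[𝓝 (Real.exp w₀)]
      fun x => (-1 + (n : ℝ) / s * ψ₁ (Real.log x)) * x⁻¹ := by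
    filter_upwards [eventually_abs_log_lt hx (by rwa [hlog])] with y hy
    exact (hψ.hasDerivAt_g n s hy.1 hy.2).deriv
  rw [saddleEta, h3.deriv_eq]
  refine h2.deriv.trans ?_
  simp only [Function.comp_apply, hlog, hsp, zero_mul, add_zero]
  field_simp

/-- The zero of `g` beyond `1` gives the dominant zero of `z^s - A(z)`. -/
theorem IsAdmissible.isDominantZero_exp {p : PMF ℕ} (hp : IsAdmissible p) {n s : ℕ} {lam u₀ : ℝ}
    (hn : (n : ℝ) = lam * s) (hn0 : n ≠ 0) (hu₀ : 0 < u₀)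
    (hr : ENNReal.ofReal (Real.exp u₀) < pgfRadius p) (hz : -u₀ + lam * cgfReal p u₀ = 0)
    (hneg : ∀ z : ℂ, 1 < ‖z‖ → ‖z‖ < Real.exp u₀ → ‖demandPgf p n z / z ^ s‖ < 1) :
    IsDominantZero p n s (Real.exp u₀) := by
  have hpos := Real.exp_pos u₀
  have hnorm : ‖((Real.exp u₀ : ℝ) : ℂ)‖ = Real.exp u₀ := by
    rw [Complex.norm_real, Real.norm_of_nonneg hpos.le]
  have heq := pgfReal_exp_pow_eq p hn hr
  rw [hz, mul_zero, Real.exp_zero, one_mul] at heq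
  refine ⟨hpos, ⟨?_, ?_, ?_⟩, ?_⟩
  · rw [hnorm]
    exact Real.one_lt_exp_iff.2 hu₀
  · rwa [hnorm]
  · rw [demandPgf, pgf_ofReal, sub_eq_zero]
    exact_mod_cast heq.symm
  · rintro w ⟨hw1, hw2, hw3⟩ hne
    by_contra! hcon
    have hw0 : w ≠ 0 := norm_pos_iff.1 (by linarith)
    rw [sub_eq_zero] at hw3
    rcases hcon.lt_or_eq with h | h
    · have := hneg w hw1 h
      rw [← hw3, div_self (pow_ne_zero s hw0), norm_one] at this
      exact lt_irrefl _ this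
    -- On the circle through the zero itself, strictness off the positive axis excludes a second
    -- zero.
    · have h1 := hp.norm_pgf_lt _ hpos hr w h hne
      have h2 : ‖pgf p w‖ ^ n < pgfReal p (Real.exp u₀) ^ n :=
        pow_lt_pow_left₀ h1 (norm_nonneg _) hn0
      rw [heq, ← h, ← norm_pow, ← norm_pow, hw3, demandPgf] at h2
      exact lt_irrefl _ h2

end ManySources

end

/-! ### Choice of constants and conclusion. -/

open ManySources in
theorem proposition4p8 (p : PMF ℕ) (hp : IsAdmissible p)
    (γmin γmax : ℝ) (hγmin : 0 < γmin) (hγmax : γmin ≤ γmax) :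
    ∃ (C : ℝ) (s₀ : ℕ), ∀ (s n : ℕ) (γ : ℝ), s₀ ≤ s → γmin ≤ γ → γ ≤ γmax →
      (n : ℝ) * mean p / (s : ℝ) = 1 - γ / Real.sqrt s →
      ∃ Z₀ zsp : ℝ, IsDominantZero p n s Z₀ ∧ IsSaddlePoint p n s Z₀ zsp ∧
        0 < saddleB p n s zsp ∧ saddleB p n s zsp < 1 ∧ 0 < saddleEta p n s zsp ∧
        ∀ (ε : ℝ) (Z : ℂ), 0 < ε → 1 + ε < Z₀ → Z₀ ≤ ‖Z‖ → zsp < Z.re →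
          ‖contourI p n s ε Z -
              J (saddleB p n s zsp)
                ((Z - (zsp : ℂ)) * ((Real.sqrt ((s : ℝ) * saddleEta p n s zsp / 2) : ℝ) : ℂ))‖
            ≤ C / Real.sqrt s := by
  have hμ := hp.mean_pos
  obtain ⟨δ, m, M, ψ₁, ψ₂, hψ⟩ := hp.exists_cgfControl
  have hδ0 := hψ.radius_pos
  have hm := hψ.m_pos
  obtain ⟨c₀, hc₀, hdecay⟩ := hp.exists_norm_pgf_le_exp (Real.one_le_exp hδ0.le) hψ.lt_radius
  have hγmax0 : 0 < γmax := hγmin.trans_le hγmax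
  -- As `λμ = 1 - γ/S` lies in `[1/2, 1]`, the ratio `λ` lies in `[l, 2l]`.
  obtain ⟨l, hl⟩ : ∃ l, l = (2 * mean p)⁻¹ := ⟨_, rfl⟩
  have hl0 : 0 < l := by rw [hl]; positivity
  have hlμ : l * mean p = 1 / 2 := by rw [hl]; field_simp
  -- `a₁` and `a₂` come from `τ/(2a) ≤ w₀ ≤ τ/a` with `τ = γ/S` and `lm ≤ a ≤ 2lm`.
  obtain ⟨C, hC⟩ := hψ.exists_norm_integral_sub_J_le hc₀ hdecay hl0
    (a₁ := γmin / (4 * l * m)) (a₂ := γmax / (l * m)) (by positivity) (by positivity)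
  -- The three summands secure `S ≥ 1`, `γ/S ≤ 1/2` and `u₀ < δ/4`.
  obtain ⟨K, hK⟩ : ∃ K, K = 1 + 2 * γmax + 12 * γmax / (l * m * δ) := ⟨_, rfl⟩
  have hK3 : 0 < 12 * γmax / (l * m * δ) := by positivity
  refine ⟨C, ⌈K ^ 2⌉₊ + 1, ?_⟩
  intro s n γ hs hγ1 hγ2 hload
  have hγ0 : 0 < γ := hγmin.trans_le hγ1
  have hsK : K ^ 2 < s := by
    calc K ^ 2 ≤ (⌈K ^ 2⌉₊ : ℝ) := Nat.le_ceil _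
      _ < (⌈K ^ 2⌉₊ + 1 : ℕ) := by push_cast; linarith
      _ ≤ s := by exact_mod_cast hs
  have hs0 : (0 : ℝ) < s := (sq_nonneg K).trans_lt hsK
  obtain ⟨S, hSdef⟩ : ∃ S, S = Real.sqrt s := ⟨_, rfl⟩
  rw [← hSdef] at hload ⊢
  have hSs : S ^ 2 = s := by rw [hSdef, Real.sq_sqrt hs0.le]
  have hSK : K < S := by rw [hSdef]; exact Real.lt_sqrt_of_sq_lt hsK
  have hS1 : 1 ≤ S := by linarith
  have hS0 : 0 < S := by linarith
  obtain ⟨lam, hlam⟩ : ∃ lam, lam = (n : ℝ) / s := ⟨_, rfl⟩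
  have hn : (n : ℝ) = lam * s := by rw [hlam]; field_simp
  have hlamμ : lam * mean p = 1 - γ / S := by rw [← hload, hlam]; ring
  have hτ : 0 < γ / S := by positivity
  have hτ2 : γ / S ≤ 1 / 2 := by
    rw [div_le_iff₀ hS0]
    linarith
  have hlam1 : l ≤ lam := le_of_mul_le_mul_right (by linarith) hμ
  have hlam2 : lam ≤ 2 * l := le_of_mul_le_mul_right (by linarith) hμ
  have hlam0 : 0 < lam := hl0.trans_le hlam1
  have hn0 : n ≠ 0 := by
    rintro rfl
    have : 0 < lam * s := mul_pos hlam0 hs0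
    rw [← hn] at this
    simp at this
  have ha : 0 < lam * m := mul_pos hlam0 hm
  have hsmall : 3 * (γ / S) / (lam * m) < δ / 4 := by
    have h1 : 12 * γmax < S * (l * m * δ) := by
      rw [← div_lt_iff₀ (by positivity)]
      linarith
    calc 3 * (γ / S) / (lam * m) ≤ 3 * (γmax / S) / (l * m) := by gcongr
      _ = 12 * γmax / (4 * S * l * m) := by field_simp; norm_num
      _ < S * (l * m * δ) / (4 * S * l * m) := by gcongr
      _ = δ / 4 := by field_simp
  obtain ⟨w₀, u₀, hw0, hwu, hu₀le, hcrit, hzero, hneg, huniq, hwl, hwu', hG1, hG2⟩ :=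
    exists_critical_zero (G := fun u => -u + lam * cgfReal p u) (G₁ := fun u => -1 + lam * ψ₁ u)
      (G₂ := fun u => lam * ψ₂ u) (δ := δ) (a := lam * m) (τ := γ / S) ha hτ (by linarith)
      (fun u hu => (hasDerivAt_id u).neg.add ((hψ.hasDerivAt u hu).const_mul lam))
      (fun u hu => ((hψ.hasDerivAt' u hu).const_mul lam).const_add (-1))
      (fun u hu => mul_le_mul_of_nonneg_left (hψ.le_second u hu) hlam0.le)
      (fun u hu => by
        have := mul_le_mul_of_nonneg_left (hψ.second_le u hu) hlam0.le
        linarith)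
      (by simp [cgfReal, pgfReal_one])
      (by simp only [hψ.at_zero, hlamμ]; ring)
  have hu₀δ : u₀ < δ / 4 := hu₀le.trans_lt hsmall
  have hu₀0 : 0 < u₀ := hw0.trans hwu
  have hrad : ∀ u, u ≤ u₀ → ENNReal.ofReal (Real.exp u) < pgfRadius p := fun u hu =>
    ofReal_lt_pgfRadius_of_le (Real.exp_le_exp.2 (by linarith)) hψ.lt_radius
  have hann : ∀ z : ℂ, 1 < ‖z‖ → ‖z‖ < Real.exp u₀ →
      ENNReal.ofReal ‖z‖ < pgfRadius p ∧ ‖demandPgf p n z / z ^ s‖ < 1 := by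
    intro z h1 h2
    have hz0 : 0 < ‖z‖ := by linarith
    have hlog1 : 0 < Real.log ‖z‖ := Real.log_pos h1
    have hlog2 : Real.log ‖z‖ < u₀ := (Real.log_lt_iff_lt_exp hz0).2 h2
    have he : ‖z‖ = Real.exp (Real.log ‖z‖) := (Real.exp_log hz0).symm
    have hr := hrad _ hlog2.le
    refine ⟨by rwa [he], ?_⟩
    refine (norm_demandPgf_div_le p hn hr he (D := 0) ?_).trans_lt ?_
    · rw [Real.exp_zero, mul_one, ← he]
      exact norm_pgf_le p (by rwa [he])
    · rw [mul_zero, add_zero, Real.exp_lt_one_iff]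
      exact mul_neg_of_pos_of_neg hs0 (hneg _ hlog1 hlog2)
  have hw₀abs : |w₀| < δ := by rw [abs_of_pos hw0]; linarith
  have hcrit' : -1 + (n : ℝ) / s * ψ₁ w₀ = 0 := by rwa [← hlam]
  have hη : saddleEta p n s (Real.exp w₀) = lam * ψ₂ w₀ / Real.exp w₀ ^ 2 := by
    rw [hψ.saddleEta_eq n s hw₀abs hcrit', hlam]
  have hψ₂pos : 0 < ψ₂ w₀ := hm.trans_le (hψ.le_second w₀ hw₀abs)
  have hηpos : 0 < saddleEta p n s (Real.exp w₀) := by rw [hη]; positivity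
  have hB : saddleB p n s (Real.exp w₀) = Real.exp (s * (-w₀ + lam * cgfReal p w₀)) := by
    rw [saddleB, g_eq_comp_log p n s (Real.exp_pos w₀), Real.log_exp, hlam]
  refine ⟨Real.exp u₀, Real.exp w₀,
    hp.isDominantZero_exp hn hn0 hu₀0 (hrad u₀ le_rfl) hzero (fun z h1 h2 => (hann z h1 h2).2),
    ⟨⟨Real.one_lt_exp_iff.2 hw0, Real.exp_lt_exp.2 hwu, ?_⟩, ?_⟩, ?_, ?_, hηpos, ?_⟩
  · have := hψ.hasDerivAt_g n s (Real.exp_pos w₀) (by rwa [Real.log_exp])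
    rwa [Real.log_exp, hcrit', zero_mul] at this
  · intro x hx1 hx2 hx
    have hx0 : 0 < x := by linarith
    have hlog1 : 0 < Real.log x := Real.log_pos hx1
    have hlog2 : Real.log x < u₀ := (Real.log_lt_iff_lt_exp hx0).2 hx2
    have h1 := hψ.hasDerivAt_g n s hx0 (by rw [abs_of_pos hlog1]; linarith)
    have h2 := (hx.unique h1).symm
    rw [← hlam] at h2
    have h3 := (mul_eq_zero.1 h2).resolve_right (inv_ne_zero hx0.ne')
    rw [← huniq _ hlog1 (by linarith) h3, Real.exp_log hx0]
  · rw [hB]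
    exact Real.exp_pos _
  · rw [hB, Real.exp_lt_one_iff]
    exact mul_neg_of_pos_of_neg hs0 (hneg w₀ hw0 hwu)
  · intro ε Z hε hεZ hZ hZre
    rw [contourI_eq_integral hann hε hεZ (Real.one_lt_exp_iff.2 (by linarith : 0 < w₀ / 2))
      (Real.exp_lt_exp.2 (by linarith)) hZ, hB]
    refine hC s n S lam w₀ _ Z hS1 hSs hn hlam1 hlam2 ?_ ?_ (by linarith) (by linarith) hG1 hG2
      (Real.sqrt_pos.2 (by positivity)) ?_ ((Real.exp_le_exp.2 hwu.le).trans hZ) hZre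
    · refine le_trans ?_ hwl
      calc γmin / (4 * l * m) / S ≤ γ / (4 * l * m) / S := by gcongr
        _ = γ / S / (2 * (2 * l * m)) := by field_simp; norm_num
        _ ≤ γ / S / (2 * (lam * m)) := by gcongr
    · refine hwu'.trans ?_
      calc γ / S / (lam * m) ≤ γmax / S / (l * m) := by gcongr
        _ = _ := by ring
    · rw [Real.sq_sqrt (by positivity), hη]
      field_simp
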